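/- **Setting.** Let $K\ge 2$. A Gaussian bandit problem with unit variances is identified with its vector of means $\mu\in\mathbb R^K$. At each round $t\ge1$ the agent pulls an arm $A_t\in\{1,\dots,K\}$ and observes $Y_t\sim\mathcal N(\mu_{A_t},1)$, independently of the past given $A_t$; $\mathcal F_t=\sigma(A_1,Y_1,\dots,A_t,Y_t)$, and $\mathbb P_\mu,\mathbb E_\mu$ are probability and expectation under $\mu$. Let $(\mathcal S_i)_{i\in\mathcal I}$ be a finite family of pairwise disjoint open convex subsets of $\mathbb R^K$, at least two of them non-empty, and $\mathcal S=\bigcup_i\mathcal S_i$. For $\mu\in\mathcal S$ let $i(\mu)$ be the index with $\mu\in\mathcal S_{i(\mu)}$. Put $\mathcal Alt(\mu)=\bigcup_{i\ne i(\mu)}\mathcal S_i$ if $\mu\in\mathcal S$ and $\mathcal Alt(\mu)=\mathcal S$ otherwise. Let $d(x,y)=(x-y)^2/2$, let $\Sigma_K$ be the probability simplex, $\pi$ its uniform distribution, $\mathrm{kl}(w,\pi)=\sum_a w_a\log(w_a/\pi_a)$, and $$F(w,\mu)=\inf_{\lambda\in\mathcal Alt(\mu)}\sum_{a=1}^K w_a\,d(\mu_a,\lambda_a)\quad(w\in[0,\infty)^K),\qquad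 T^\star(\mu)^{-1}=\max_{w\in\Sigma_K}F(w,\mu).$$ For every $\mu\in\mathbb R^K$ and every $w\in\Sigma_K$ with positive coordinates let $\nabla F(w,\mu)$ be a chosen sub-gradient (super-gradient) at $w$ of the concave function $F(\cdot,\mu)$ on $[0,\infty)^K$. **Assumption (bounded sub-gradients).** For all $\mu\in\mathcal S$ there are $\kappa_0>0$ and $L$, which may depend on $\mu$, such that $0\le\nabla_aF(w,\mu')\le L$ for all $a$, all $w\in\Sigma_K$ with positive coordinates and all $\mu'$ with $|\mu'-\mu|_\infty<\kappa_0$. **Algorithm.** Fix $M>0$, let $\eta_t=1/\sqrt t$, $\gamma_t=1/(4\sqrt t)$ and $\mathrm{clip}_t(x)=(\min(x_a,M\sqrt t))_a$. Let $N_a(t)$ be the number of pulls of arm $a$ in rounds $1,\dots,t$ and $\widehat\mu_a(t)$ the average of the rewards received from them. Pull each arm once in the first $K$ rounds, and set $\widetilde w(t)=w'(t)=\pi$ for $1\le t\le K$. For $t\ge K$ let $$\widetilde w(t+1)=\operatorname*{argmax}_{w\in\Sigma_K}\ \eta_{t+1}\sum_{s=K}^t w\cdot\mathrm{clip}_s\big(\nabla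 F(\widetilde w(s),\widehat\mu(s))\big)-\mathrm{kl}(w,\pi),\qquad w'(t+1)=(1-\gamma_t)\widetilde w(t+1)+\gamma_t\pi,$$ $$A_{t+1}\in\operatorname*{argmax}_{a}\ \sum_{s=1}^{t+1}w'_a(s)-N_a(t).$$ For $\delta\in(0,1)$ stop at $$\tau_\delta=\inf\Big\{t\ge K:\ \inf_{\lambda\in\mathcal Alt(\widehat\mu(t))}\sum_{a}N_a(t)\,d(\widehat\mu_a(t),\lambda_a)\ge\beta(N(t),\delta)\Big\}$$ and output $\widehat\imath\in\operatorname*{argmin}_{i\in\mathcal I}\inf_{\lambda\in\mathcal S_i}\sum_aN_a(\tau_\delta)\,d(\widehat\mu_a(\tau_\delta),\lambda_a)$. Ties are broken arbitrarily, but so that $A_{t+1}$ is $\mathcal F_t$-measurable and $\widehat\imath$ is $\mathcal F_{\tau_\delta}$-measurable. The threshold is $$\beta(N(t),\delta)=\log(1/\delta)+K\log\big(4\log(1/\delta)+1\big)+6\sum_{a=1}^K\log\big(\log N_a(t)+3\big)+K\widetilde C,$$ where $\widetilde C=5\log(2C)$, $\log C=1-2\log C_{1/2}$ and $C_{1/2}$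 is the constant for which $x\mapsto C_{1/2}\,|x|^{-1}\big(\big|\log|x|\big|+2\big)^{-3/2}$ is a probability density on $\mathbb R$. **Theorem.** Under the assumption, for every $\delta\in(0,1)$ the algorithm is $\delta$-correct: $A_{t+1}$ is $\mathcal F_t$-measurable for every $t\ge 0$, $\tau_\delta$ is a stopping time of $(\mathcal F_t)$, $\widehat\imath$ is $\mathcal F_{\tau_\delta}$-measurable, and for all $\mu\in\mathcal S$ one has $\mathbb P_\mu(\widehat\imath\ne i(\mu))\le\delta$ and $\mathbb P_\mu(\tau_\delta<\infty)=1$. It is also asymptotically optimal: for all $\mu\in\mathcal S$, $$\limsup_{\delta\to0}\frac{\mathbb E_\mu[\tau_\delta]}{\log(1/\delta)}\le T^\star(\mu).$$ -/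

import Mathlib

open MeasureTheory ProbabilityTheory Filter Topology
open scoped ENNReal

/-! Active exploration for Gaussian bandits with unit variance. A bandit problem with `K` arms is its
vector of means `μ : Fin K → ℝ`. Rounds are numbered `1, 2, 3, …`; the values of processes at
index `0` are never used. -/

namespace ActiveExploration

noncomputable section

variable {K : ℕ} {I Ω : Type*}

/-! ### The identification problem and the characteristic time -/

/-- Kullback-Leibler divergence between `N(x, 1)` and `N(y, 1)`. -/
def gaussDiv (x y : ℝ) : ℝ := (x - y) ^ 2 / 2

/-- `inf_{lam ∈ B} ∑ a, w a * d(μ a, lam a)` for nonnegative weights `w`, with values in `[0, ∞]`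
(so that the infimum over the empty set is `∞`). -/
def infCost (w μ : Fin K → ℝ) (B : Set (Fin K → ℝ)) : ℝ≥0∞ :=
  ⨅ lam ∈ B, ENNReal.ofReal (∑ a, w a * gaussDiv (μ a) (lam a))

/-- The set of alternatives: the union of the `S i` that do not contain `μ`. As the `S i` are
pairwise disjoint, it is the union of all `S i` if `μ` lies in none of them, and
`⋃ i ≠ i(μ), S i` otherwise. -/
def alt (S : I → Set (Fin K → ℝ)) (μ : Fin K → ℝ) : Set (Fin K → ℝ) :=
  ⋃ i ∈ {i | μ ∉ S i}, S i

/-- `F(w, μ) = inf_{lam ∈ Alt(μ)} ∑ a, w a * d(μ a, lam a)`, for `w` with nonnegative coordinates.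
(The infimum is finite as soon as `Alt(μ)` is nonempty.) -/
def objective (S : I → Set (Fin K → ℝ)) (w μ : Fin K → ℝ) : ℝ :=
  (infCost w μ (alt S μ)).toReal

/-- The characteristic time, the inverse of the maximum of `F(·, μ)` over the simplex. -/
def charTime (S : I → Set (Fin K → ℝ)) (μ : Fin K → ℝ) : ℝ≥0∞ :=
  (⨆ w ∈ stdSimplex ℝ (Fin K), infCost w μ (alt S μ))⁻¹

/-! ### Sub-gradients -/

/-- `g` is a sub-gradient (super-gradient) at `w` of the concave function `f` on the orthant
of vectors with nonnegative coordinates. -/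
def IsSubgradient (f : (Fin K → ℝ) → ℝ) (w g : Fin K → ℝ) : Prop :=
  ∀ v : Fin K → ℝ, (∀ a, 0 ≤ v a) → f v ≤ f w + ∑ a, g a * (v a - w a)

/-- `grad w μ` is, for every `μ` and every `w` in the simplex with positive coordinates, an element
of the sub-gradient of `F(·, μ)` at `w`. -/
def IsSubgradientSelection (S : I → Set (Fin K → ℝ))
    (grad : (Fin K → ℝ) → (Fin K → ℝ) → Fin K → ℝ) : Prop :=
  ∀ μ : Fin K → ℝ, ∀ w ∈ stdSimplex ℝ (Fin K), (∀ a, 0 < w a) →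
    IsSubgradient (fun v => objective S v μ) w (grad w μ)

/-- Near every `μ` in one of the `S i`, the chosen sub-gradients have coordinates in `[0, L]`, where
`L` and the radius may depend on `μ`. (`Metric.ball` is the ball of the sup norm here.) -/
def BoundedSubgradients (S : I → Set (Fin K → ℝ))
    (grad : (Fin K → ℝ) → (Fin K → ℝ) → Fin K → ℝ) : Prop :=
  ∀ μ ∈ ⋃ i, S i, ∃ κ : ℝ, 0 < κ ∧ ∃ L : ℝ, ∀ w ∈ stdSimplex ℝ (Fin K), (∀ a, 0 < w a) →
    ∀ ν ∈ Metric.ball μ κ, ∀ a, 0 ≤ grad w ν a ∧ grad w ν a ≤ L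

/-! ### Statistics of a sequence of arms `a` and rewards `y` -/

/-- `N_b(t)`, the number of pulls of arm `b` in rounds `1, …, t`. -/
def pulls (a : ℕ → Fin K) (t : ℕ) (b : Fin K) : ℕ :=
  ((Finset.Icc 1 t).filter fun s => a s = b).card

/-- The vector of empirical means after round `t`. -/
def empMean (a : ℕ → Fin K) (y : ℕ → ℝ) (t : ℕ) (b : Fin K) : ℝ :=
  (1 / (pulls a t b : ℝ)) * ∑ s ∈ Finset.Icc 1 t, if a s = b then y s else 0

/-! ### The algorithm -/

/-- The uniform distribution on the arms. -/
def unif (K : ℕ) : Fin K → ℝ := fun _ => 1 / (K : ℝ)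

/-- Kullback-Leibler divergence between distributions on the arms. -/
def kl (w v : Fin K → ℝ) : ℝ := ∑ a, w a * Real.log (w a / v a)

/-- Clipping of a gradient at level `M * √t`. -/
def clip (M : ℝ) (t : ℕ) (x : Fin K → ℝ) : Fin K → ℝ := fun a => min (x a) (M * √(t : ℝ))

/-- The quantity maximised over the simplex by the lazy mirror ascent to find the weights of round
`t + 1`; `wt s` are the weights of round `s`. -/
def mirrorObjective (grad : (Fin K → ℝ) → (Fin K → ℝ) → Fin K → ℝ) (M : ℝ) (η : ℕ → ℝ)
    (a : ℕ → Fin K) (y : ℕ → ℝ) (wt : ℕ → Fin K → ℝ) (t : ℕ) (w : Fin K → ℝ) : ℝ :=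
  η (t + 1) * ∑ s ∈ Finset.Icc K t, ∑ b, w b * clip M s (grad (wt s) (empMean a y s)) b
    - kl w (unif K)

/-- The weights `w'(s)`: uniform for `s ≤ K`, and
`w'(t + 1) = (1 - γ t) wt (t + 1) + γ t * unif` for `t ≥ K`. -/
def exploredWeights (γ : ℕ → ℝ) (wt : ℕ → Fin K → ℝ) (s : ℕ) : Fin K → ℝ :=
  if s ≤ K then unif K
  else fun b => (1 - γ (s - 1)) * wt s b + γ (s - 1) * unif K b

/-- The arms `a`, the rewards `y` and the weights `wt` are those of a run of the sampling rule, with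
learning rates `η`, exploration rates `γ` and clipping constant `M`. Ties are broken arbitrarily. -/
structure IsRun (grad : (Fin K → ℝ) → (Fin K → ℝ) → Fin K → ℝ) (M : ℝ) (η γ : ℕ → ℝ)
    (a : ℕ → Fin K) (y : ℕ → ℝ) (wt : ℕ → Fin K → ℝ) : Prop where
  /-- The first `K` rounds pull each arm once. -/
  init_pulls : ∀ b, pulls a K b = 1
  init_weights : ∀ t, 1 ≤ t → t ≤ K → wt t = unif K
  /-- Online lazy mirror ascent. -/
  ascent_mem : ∀ t, K ≤ t → wt (t + 1) ∈ stdSimplex ℝ (Fin K)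
  ascent_max : ∀ t, K ≤ t →
    IsMaxOn (mirrorObjective grad M η a y wt t) (stdSimplex ℝ (Fin K)) (wt (t + 1))
  /-- Tracking of the cumulative weights. -/
  tracking : ∀ t, K ≤ t → ∀ b,
    ∑ s ∈ Finset.Icc 1 (t + 1), exploredWeights γ wt s b - (pulls a t b : ℝ) ≤
      ∑ s ∈ Finset.Icc 1 (t + 1), exploredWeights γ wt s (a (t + 1)) - (pulls a t (a (t + 1)) : ℝ)

/-- The stopping rule with threshold `β n δ`: the first `t ≥ K` such that
`inf_{lam ∈ Alt(μ̂(t))} ∑ b, N_b(t) d(μ̂_b(t), lam b) ≥ β (N(t)) δ`, and `⊤` if there is none. -/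
def stopTime (S : I → Set (Fin K → ℝ)) (β : (Fin K → ℕ) → ℝ → ℝ) (δ : ℝ)
    (a : ℕ → Fin K) (y : ℕ → ℝ) : ℕ∞ :=
  sInf {n : ℕ∞ | ∃ t : ℕ, n = t ∧ K ≤ t ∧ ENNReal.ofReal (β (pulls a t) δ) ≤
    infCost (fun b => (pulls a t b : ℝ)) (empMean a y t) (alt S (empMean a y t))}

/-- The decision rule at a time `t`: `i` minimises `inf_{lam ∈ S i} ∑ b, N_b(t) d(μ̂_b(t), lam b)`. -/
def IsDecision (S : I → Set (Fin K → ℝ)) (a : ℕ → Fin K) (y : ℕ → ℝ) (t : ℕ) (i : I) : Prop :=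
  ∀ j, infCost (fun b => (pulls a t b : ℝ)) (empMean a y t) (S i) ≤
    infCost (fun b => (pulls a t b : ℝ)) (empMean a y t) (S j)

/-! ### The threshold -/

/-- The constant `C_{1/2}` that makes `x ↦ C_{1/2} / (|x| (|log |x|| + 2)^{3/2})` a probability
density on the real line. -/
def mixtureNorm : ℝ :=
  (∫ x : ℝ, 1 / (|x| * (abs (Real.log |x|) + 2) ^ (3 / 2 : ℝ)))⁻¹

/-- The universal constant `5 log (2 C)`, where `log C = 1 - 2 log C_{1/2}`. -/
def thresholdConst : ℝ := 5 * Real.log (2 * Real.exp (1 - 2 * Real.log mixtureNorm))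

/-- The threshold `β(n, δ)` as a function of the vector `n` of numbers of pulls. -/
def threshold (n : Fin K → ℕ) (δ : ℝ) : ℝ :=
  Real.log (1 / δ) + K * Real.log (4 * Real.log (1 / δ) + 1)
    + 6 * ∑ a, Real.log (Real.log (n a : ℝ) + 3) + K * thresholdConst

/-! ### The probabilistic model -/

/-- The filtration `F_t = σ(A_1, Y_1, …, A_t, Y_t)`. -/
def history [mΩ : MeasurableSpace Ω] {A : ℕ → Ω → Fin K} {Y : ℕ → Ω → ℝ}
    (hA : ∀ t, Measurable (A t)) (hY : ∀ t, Measurable (Y t)) : Filtration ℕ mΩ where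
  seq t := ⨆ s ∈ Set.Icc 1 t, MeasurableSpace.comap (fun ω => (A s ω, Y s ω)) inferInstance
  mono' := fun _ _ h => biSup_mono fun _ hs => ⟨hs.1, hs.2.trans h⟩
  le' := fun _ => iSup₂_le fun s _ => ((hA s).prodMk (hY s)).comap_le

/-- Under `P`, the arms `A` and rewards `Y` follow the Gaussian bandit problem `μ`: the noise
`Y_{t+1} - μ_{A_{t+1}}` is standard Gaussian and independent of `F_t`. When `A_{t+1}` is
`F_t`-measurable, this says that, conditionally on `F_t`, the reward `Y_{t+1}` has
law `N(μ_{A_{t+1}}, 1)`. -/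
structure IsGaussianBandit [MeasurableSpace Ω] {A : ℕ → Ω → Fin K} {Y : ℕ → Ω → ℝ}
    (hA : ∀ t, Measurable (A t)) (hY : ∀ t, Measurable (Y t))
    (μ : Fin K → ℝ) (P : Measure Ω) : Prop where
  noise_law : ∀ t : ℕ,
    HasLaw (fun ω => Y (t + 1) ω - μ (A (t + 1) ω)) (gaussianReal 0 1) P
  noise_indep : ∀ t : ℕ,
    Indep (MeasurableSpace.comap (fun ω => Y (t + 1) ω - μ (A (t + 1) ω)) inferInstance)
      (history hA hY t) P

/-- The strategy with arms `A`, stopping time `τ` and decision `ihat` is `δ`-correct for the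
identification problem `S`; `P μ` is the probability under the bandit problem `μ`. -/
structure IsDeltaCorrect [MeasurableSpace Ω] (S : I → Set (Fin K → ℝ))
    {A : ℕ → Ω → Fin K} {Y : ℕ → Ω → ℝ}
    (hA : ∀ t, Measurable (A t)) (hY : ∀ t, Measurable (Y t))
    (P : (Fin K → ℝ) → Measure Ω) (τ : Ω → ℕ∞) (ihat : Ω → I) (δ : ℝ) : Prop where
  sampling : ∀ t, Measurable[history hA hY t] (A (t + 1))
  stopping : IsStoppingTime (history hA hY) τ
  /-- The decision, which is taken when `τ` is finite, is measurable for `F_τ`. -/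
  decision : ∀ i, ∀ t : ℕ, MeasurableSet[history hA hY t] ({ω | ihat ω = i} ∩ {ω | τ ω ≤ t})
  correct : ∀ i, ∀ μ ∈ S i, P μ {ω | ihat ω ≠ i} ≤ ENNReal.ofReal δ
  finite : ∀ μ ∈ ⋃ i, S i, ∀ᵐ ω ∂(P μ), τ ω < ⊤

end

end ActiveExploration

/-! Correctness. A wrong decision at the stopping time puts the true `μ` among the alternatives of
the empirical means, so `∑ N_a d(μ̂_a, μ_a)` reaches the threshold (`threshold_le_cost_of_ne`). This
is excluded up to probability `δ` by the method of mixtures. The likelihood ratio of `μ + θ` against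
`μ` is a martingale of mean one, hence so is its average over a product prior in `θ`, and it ever
reaches `1 / δ` with probability at most `δ` (`measure_exists_mixture_ge_le`). The prior charges a
short interval near the maximiser of each arm's exponent (`exists_set_mixture_ge`), and the
threshold pays for what is lost there (`le_sum_sub_loss`).

Sample complexity. Fix weights `v` whose worst cost against the alternatives of `μ` exceeds `c`.
Suppose the empirical means stay near `μ` in all rounds between `√T` and `T`. There the gradients
are bounded and the alternatives do not change, so exponential weights have regret `o(T)` against
`v` (`expWeights_regret`); earlier rounds are controlled by the clipping and cost only `O(T^(3/4))`.
Tracking keeps the pulls within a constant of the cumulative weights (`IsRun.pulls_le_sum`,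
`IsRun.sum_le_pulls`). Hence the stopping statistic is at least `c T` for large `T`
(`exists_radius_le_cost_pulls`), and the algorithm has stopped once `c T` passes the threshold.

Forced exploration gives every arm order `√t` pulls by round `t`, so a bad mean at `t` has
probability `exp(-const √t)`. This is summable against `t² + 1`, the weight that
`lintegral_le_add_tsum_bad` requires. Thus `E τ ≤ D + (log(1/δ) + K log(4 log(1/δ) + 1)) / c` with
`D` free of `δ` (`lintegral_stopTime_le`). Uniform weights already give almost sure stopping;
letting `δ → 0`, then raising `c` and varying `v`, gives the bound by `T*`. -/

namespace ActiveExploration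

/-! ### Exponential weights -/

/-- The exponential weights of a vector of gains. -/
noncomputable def softmax {K : ℕ} (H : Fin K → ℝ) (b : Fin K) : ℝ :=
  Real.exp (H b) / ∑ c, Real.exp (H c)

/-- The log-average-exponential of a vector of gains. -/
noncomputable def logMeanExp {K : ℕ} (H : Fin K → ℝ) : ℝ :=
  Real.log ((1 / (K : ℝ)) * ∑ b, Real.exp (H b))

lemma unif_eq_softmax_zero {K : ℕ} : unif K = softmax (fun _ : Fin K => (0 : ℝ)) := by
  ext b
  simp [unif, softmax]

section

variable {K : ℕ} [NeZero K]

lemma natCast_arms_pos : (0 : ℝ) < K := Nat.cast_pos.2 (Nat.pos_of_ne_zero (NeZero.ne K))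

lemma sum_exp_pos (H : Fin K → ℝ) : 0 < ∑ b, Real.exp (H b) :=
  Finset.sum_pos (fun _ _ => Real.exp_pos _) ⟨0, Finset.mem_univ _⟩

lemma softmax_pos (H : Fin K → ℝ) (b : Fin K) : 0 < softmax H b :=
  div_pos (Real.exp_pos _) (sum_exp_pos H)

lemma sum_softmax (H : Fin K → ℝ) : ∑ b, softmax H b = 1 := by
  simp only [softmax, ← Finset.sum_div]
  exact div_self (sum_exp_pos H).ne'

lemma softmax_mem_stdSimplex (H : Fin K → ℝ) : softmax H ∈ stdSimplex ℝ (Fin K) :=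
  ⟨fun b => (softmax_pos H b).le, sum_softmax H⟩

/-- The Gibbs variational principle, with its remainder. -/
lemma gain_sub_kl_eq {w : Fin K → ℝ} (hw : w ∈ stdSimplex ℝ (Fin K)) (H : Fin K → ℝ) :
    ∑ b, w b * H b - kl w (unif K) =
      logMeanExp H - ∑ b, softmax H b * InformationTheory.klFun (w b / softmax H b) := by
  have hK := natCast_arms_pos (K := K)
  have hZ := sum_exp_pos H
  -- With `p` the softmax, `p * klFun (w / p) = w log (w / p) + p - w`. The extra `p - w` cancels in
  -- the sum, and makes each term of the remainder separately nonnegative.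
  have key : ∀ b, softmax H b * InformationTheory.klFun (w b / softmax H b) =
      w b * Real.log (w b / unif K b) - w b * H b + w b * logMeanExp H
        + softmax H b - w b := by
    intro b
    have hp := softmax_pos H b
    rcases (hw.1 b).eq_or_lt with h0 | hpos
    · simp [← h0, InformationTheory.klFun]
    · have h1 : Real.log (w b / softmax H b) =
          Real.log (w b / unif K b) - H b + logMeanExp H := by
        rw [Real.log_div hpos.ne' hp.ne', softmax, Real.log_div (Real.exp_ne_zero _) hZ.ne',
          Real.log_exp, unif, Real.log_div hpos.ne' (by positivity), logMeanExp,
          Real.log_mul (by positivity) hZ.ne']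
        ring
      rw [InformationTheory.klFun, h1]
      field_simp
  simp only [key, Finset.sum_sub_distrib, Finset.sum_add_distrib, ← Finset.sum_mul, hw.2,
    sum_softmax, kl]
  ring

lemma gain_sub_kl_le {w : Fin K → ℝ} (hw : w ∈ stdSimplex ℝ (Fin K)) (H : Fin K → ℝ) :
    ∑ b, w b * H b - kl w (unif K) ≤ logMeanExp H := by
  rw [gain_sub_kl_eq hw H, sub_le_self_iff]
  exact Finset.sum_nonneg fun b _ => mul_nonneg (softmax_pos H b).le
    (InformationTheory.klFun_nonneg (div_nonneg (hw.1 b) (softmax_pos H b).le))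

lemma gain_sub_kl_softmax (H : Fin K → ℝ) :
    ∑ b, softmax H b * H b - kl (softmax H) (unif K) = logMeanExp H := by
  rw [gain_sub_kl_eq (softmax_mem_stdSimplex H) H]
  simp [(softmax_pos H _).ne', InformationTheory.klFun]

/-- At a maximiser the remainder vanishes, hence each of its nonnegative terms does, and `klFun` is
zero only at `1`. -/
lemma eq_softmax_of_isMaxOn {w : Fin K → ℝ} (hw : w ∈ stdSimplex ℝ (Fin K)) (H : Fin K → ℝ)
    (hmax : IsMaxOn (fun v => ∑ b, v b * H b - kl v (unif K)) (stdSimplex ℝ (Fin K)) w) :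
    w = softmax H := by
  have h1 := hmax (softmax_mem_stdSimplex H)
  simp only [Set.mem_ofPred_eq, gain_sub_kl_softmax, gain_sub_kl_eq hw H] at h1
  have hnn : ∀ b ∈ Finset.univ,
      0 ≤ softmax H b * InformationTheory.klFun (w b / softmax H b) := fun b _ =>
    mul_nonneg (softmax_pos H b).le
      (InformationTheory.klFun_nonneg (div_nonneg (hw.1 b) (softmax_pos H b).le))
  have h2 := (Finset.sum_eq_zero_iff_of_nonneg hnn).1
    (le_antisymm (by linarith) (Finset.sum_nonneg hnn))
  ext b
  have h3 := (mul_eq_zero.1 (h2 b (Finset.mem_univ b))).resolve_left (softmax_pos H b).ne'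
  rw [InformationTheory.klFun_eq_zero_iff (div_nonneg (hw.1 b) (softmax_pos H b).le)] at h3
  exact (div_eq_one_iff_eq (softmax_pos H b).ne').1 h3

lemma kl_unif_nonneg {w : Fin K → ℝ} (hw : w ∈ stdSimplex ℝ (Fin K)) : 0 ≤ kl w (unif K) := by
  have hK := natCast_arms_pos (K := K)
  have := gain_sub_kl_le hw 0
  simp [logMeanExp, hK.ne'] at this
  exact this

lemma kl_unif_le {w : Fin K → ℝ} (hw : w ∈ stdSimplex ℝ (Fin K)) :
    kl w (unif K) ≤ Real.log K := by
  have hK := natCast_arms_pos (K := K)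
  have : ∀ b, w b * Real.log (w b / unif K b) ≤ w b * Real.log K := by
    intro b
    rcases (hw.1 b).eq_or_lt with h0 | hpos
    · simp [← h0]
    · refine mul_le_mul_of_nonneg_left (Real.log_le_log (div_pos hpos (by simp [unif, hK])) ?_)
        hpos.le
      have : w b ≤ 1 := hw.2 ▸ Finset.single_le_sum (fun c _ => hw.1 c) (Finset.mem_univ b)
      rw [unif, div_div_eq_mul_div, div_one]
      nlinarith
  calc kl w (unif K) ≤ ∑ b, w b * Real.log K := Finset.sum_le_sum fun b _ => this b
    _ = Real.log K := by rw [← Finset.sum_mul, hw.2, one_mul]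

/-- The potential `log (mean (exp (η G))) / η` is nondecreasing in the learning rate. -/
lemma potential_mono {η η' : ℝ} (hη : 0 < η) (h : η ≤ η') (G : Fin K → ℝ) :
    logMeanExp (fun b => η * G b) / η ≤ logMeanExp (fun b => η' * G b) / η' := by
  have hη' := hη.trans_le h
  -- The potential is the maximum over `w` of `w · G - kl w / η`. Its maximiser at `η` is a
  -- competitor at `η'`, where the penalty is smaller.
  set w := softmax (fun b => η * G b)
  have hw : w ∈ stdSimplex ℝ (Fin K) := softmax_mem_stdSimplex _
  have h1 : logMeanExp (fun b => η * G b) = η * ∑ b, w b * G b - kl w (unif K) := by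
    rw [← gain_sub_kl_softmax, Finset.mul_sum]
    congr 1
    exact Finset.sum_congr rfl fun b _ => by ring
  have h2 : η' * ∑ b, w b * G b - kl w (unif K) ≤ logMeanExp (fun b => η' * G b) := by
    refine le_trans (le_of_eq ?_) (gain_sub_kl_le hw _)
    rw [Finset.mul_sum]
    congr 1
    exact Finset.sum_congr rfl fun b _ => by ring
  have hkl := kl_unif_nonneg hw
  calc logMeanExp (fun b => η * G b) / η = ∑ b, w b * G b - kl w (unif K) / η := by
        rw [h1]; field_simp
    _ ≤ ∑ b, w b * G b - kl w (unif K) / η' := by gcongr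
    _ = (η' * ∑ b, w b * G b - kl w (unif K)) / η' := by field_simp
    _ ≤ _ := by gcongr

/-- One step of exponential weights. -/
lemma logMeanExp_add_le (H x : Fin K → ℝ) {B : ℝ} (h0 : ∀ b, 0 ≤ x b) (hB : ∀ b, x b ≤ B)
    (hB1 : B ≤ 1) :
    logMeanExp (fun b => H b + x b) ≤ logMeanExp H + ∑ b, softmax H b * x b + B ^ 2 := by
  have hK := natCast_arms_pos (K := K)
  have hZ := sum_exp_pos H
  -- `exp x ≤ 1 + x + x²` for `|x| ≤ 1`; with `log (1 + u) ≤ u` at the end, this is the usual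
  -- second-order bound.
  have h1 : ∀ b, Real.exp (H b + x b) ≤ Real.exp (H b) * (1 + x b + B ^ 2) := by
    intro b
    rw [Real.exp_add]
    refine mul_le_mul_of_nonneg_left ?_ (Real.exp_pos _).le
    have h2 := Real.abs_exp_sub_one_sub_id_le (x := x b)
      (abs_le.2 ⟨by linarith [h0 b], (hB b).trans hB1⟩)
    have h3 : x b ^ 2 ≤ B ^ 2 := pow_le_pow_left₀ (h0 b) (hB b) 2
    linarith [(abs_le.1 h2).2]
  have h2 : ∑ b, Real.exp (H b + x b) ≤
      (∑ b, Real.exp (H b)) * (1 + (∑ b, softmax H b * x b + B ^ 2)) := by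
    calc _ ≤ ∑ b, Real.exp (H b) * (1 + x b + B ^ 2) := Finset.sum_le_sum fun b _ => h1 b
      _ = _ := by
        have : ∀ b, Real.exp (H b) = (∑ b, Real.exp (H b)) * softmax H b := fun b => by
          rw [softmax]; field_simp
        have h5 : ∀ b, Real.exp (H b) * (1 + x b + B ^ 2) = (∑ b, Real.exp (H b)) *
            (softmax H b * (1 + B ^ 2) + softmax H b * x b) := fun b => by
          conv_lhs => rw [this b]
          ring
        simp only [h5, ← Finset.mul_sum, Finset.sum_add_distrib, ← Finset.sum_mul, sum_softmax]
        ring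
  have h3 : 0 ≤ ∑ b, softmax H b * x b + B ^ 2 :=
    add_nonneg (Finset.sum_nonneg fun b _ => mul_nonneg (softmax_pos H b).le (h0 b)) (sq_nonneg B)
  calc logMeanExp (fun b => H b + x b)
      ≤ Real.log ((1 / (K : ℝ) * ∑ b, Real.exp (H b)) *
          (1 + (∑ b, softmax H b * x b + B ^ 2))) := by
        refine Real.log_le_log (mul_pos (by positivity) (sum_exp_pos _)) ?_
        rw [mul_assoc]
        gcongr
    _ = logMeanExp H + Real.log (1 + (∑ b, softmax H b * x b + B ^ 2)) := by
        rw [Real.log_mul (by positivity) (by positivity), logMeanExp]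
    _ ≤ _ := by
        have := Real.log_le_sub_one_of_pos (x := 1 + (∑ b, softmax H b * x b + B ^ 2))
          (by positivity)
        linarith

lemma logMeanExp_le {H : Fin K → ℝ} {B : ℝ} (hB : ∀ b, H b ≤ B) : logMeanExp H ≤ B := by
  have hK := natCast_arms_pos (K := K)
  rw [logMeanExp, Real.log_le_iff_le_exp (mul_pos (by positivity) (sum_exp_pos _))]
  calc 1 / (K : ℝ) * ∑ b, Real.exp (H b) ≤ 1 / (K : ℝ) * ∑ _b : Fin K, Real.exp B := by
        gcongr with b; exact hB b
    _ = Real.exp B := by simp [hK.ne']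

/-- Regret of exponential weights with decreasing learning rates over rounds `s₀, …, T`, when
past rounds `< s₀` had gains summing to `G₀ ∈ [0, B]`. -/
lemma expWeights_regret (η : ℕ → ℝ) (hη : ∀ s, 1 ≤ s → 0 < η s)
    (hanti : ∀ s, 1 ≤ s → η (s + 1) ≤ η s)
    (G g w : ℕ → Fin K → ℝ) {s₀ T : ℕ} (hs₀ : 1 ≤ s₀) (hT : s₀ ≤ T)
    (hG : ∀ s, s₀ ≤ s → ∀ b, G (s + 1) b = G s b + g s b)
    (hw : ∀ s, s₀ ≤ s → w s = softmax (fun b => η s * G s b))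
    {B L : ℝ} (hG0 : ∀ b, 0 ≤ G s₀ b) (hGB : ∀ b, G s₀ b ≤ B)
    (hg0 : ∀ s, s₀ ≤ s → s ≤ T → ∀ b, 0 ≤ g s b) (hgL : ∀ s, s₀ ≤ s → s ≤ T → ∀ b, g s b ≤ L)
    (hηL : η s₀ * L ≤ 1) {v : Fin K → ℝ} (hv : v ∈ stdSimplex ℝ (Fin K)) :
    ∑ s ∈ Finset.Icc s₀ T, ∑ b, g s b * (v b - w s b) ≤
      Real.log K / η (T + 1) + B + L ^ 2 * ∑ s ∈ Finset.Icc s₀ T, η s := by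
  have hL : 0 ≤ L := (hg0 s₀ le_rfl hT 0).trans (hgL s₀ le_rfl hT 0)
  have hle : ∀ s, s₀ ≤ s → η s ≤ η s₀ := by
    intro s hs
    induction s, hs using Nat.le_induction with
    | base => exact le_rfl
    | succ s hs ih => exact (hanti s (hs₀.trans hs)).trans ih
  -- Telescoping of the potential: in a round it grows by at most the gain of the player plus `L²
  -- η`, and then lowering the rate can only decrease it.
  have main : ∀ t, s₀ ≤ t → t ≤ T + 1 → logMeanExp (fun b => η t * G t b) / η t ≤
      B + ∑ s ∈ Finset.Ico s₀ t, (∑ b, w s b * g s b + L ^ 2 * η s) := by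
    intro t ht
    induction t, ht using Nat.le_induction with
    | base =>
      intro _
      simp only [Finset.Ico_self, Finset.sum_empty, add_zero]
      rw [div_le_iff₀ (hη _ hs₀), mul_comm B]
      exact logMeanExp_le fun b => mul_le_mul_of_nonneg_left (hGB b) (hη _ hs₀).le
    | succ t ht ih =>
      intro htT
      have ht1 : 1 ≤ t := hs₀.trans ht
      have hpos := hη t ht1
      have h1 := potential_mono (hη (t + 1) (by omega)) (hanti t ht1) (G (t + 1))
      have h2 : logMeanExp (fun b => η t * G (t + 1) b) ≤ logMeanExp (fun b => η t * G t b)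
          + ∑ b, w t b * (η t * g t b) + (η t * L) ^ 2 := by
        rw [hw t ht]
        simp only [hG t ht, mul_add]
        exact logMeanExp_add_le _ _ (fun b => mul_nonneg hpos.le (hg0 t ht (by omega) b))
          (fun b => mul_le_mul_of_nonneg_left (hgL t ht (by omega) b) hpos.le)
          ((mul_le_mul_of_nonneg_right (hle t ht) hL).trans hηL)
      have h3 : logMeanExp (fun b => η t * G (t + 1) b) / η t ≤
          logMeanExp (fun b => η t * G t b) / η t + (∑ b, w t b * g t b + L ^ 2 * η t) := by
        rw [div_add' _ _ _ hpos.ne']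
        refine div_le_div_of_nonneg_right (h2.trans (le_of_eq ?_)) hpos.le
        rw [add_mul, Finset.sum_mul, add_assoc]
        congr 2
        · exact Finset.sum_congr rfl fun b _ => by ring
        · ring
      rw [Finset.sum_Ico_succ_top ht]
      linarith [ih (by omega)]
  have hpos := hη (T + 1) (by omega)
  have h1 := main (T + 1) (by omega) le_rfl
  -- The final potential dominates the gain of any fixed `v` up to `kl v / η ≤ log K / η`.
  have h2 : ∑ b, v b * G (T + 1) b - Real.log K / η (T + 1) ≤
      logMeanExp (fun b => η (T + 1) * G (T + 1) b) / η (T + 1) := by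
    rw [le_div_iff₀ hpos, sub_mul, div_mul_cancel₀ _ hpos.ne', Finset.sum_mul]
    refine le_trans ?_ (gain_sub_kl_le hv _)
    refine sub_le_sub (le_of_eq (Finset.sum_congr rfl fun b _ => by ring)) (kl_unif_le hv)
  have h3 : ∀ t, s₀ ≤ t → ∑ b, v b * G t b =
      ∑ b, v b * G s₀ b + ∑ s ∈ Finset.Ico s₀ t, ∑ b, v b * g s b := by
    intro t ht
    induction t, ht using Nat.le_induction with
    | base => simp
    | succ t ht ih =>
      rw [Finset.sum_Ico_succ_top ht, ← add_assoc, ← ih, ← Finset.sum_add_distrib]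
      exact Finset.sum_congr rfl fun b _ => by rw [hG t ht]; ring
  have h4 := h3 (T + 1) (by omega)
  have h5 : 0 ≤ ∑ b, v b * G s₀ b := Finset.sum_nonneg fun b _ => mul_nonneg (hv.1 b) (hG0 b)
  have h6 : Finset.Ico s₀ (T + 1) = Finset.Icc s₀ T := by ext; simp
  rw [h6] at h4 h1
  have h7 : ∑ s ∈ Finset.Icc s₀ T, ∑ b, g s b * (v b - w s b) =
      ∑ s ∈ Finset.Icc s₀ T, ∑ b, v b * g s b - ∑ s ∈ Finset.Icc s₀ T, ∑ b, w s b * g s b := by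
    rw [← Finset.sum_sub_distrib]
    refine Finset.sum_congr rfl fun s _ => ?_
    rw [← Finset.sum_sub_distrib]
    exact Finset.sum_congr rfl fun b _ => by ring
  rw [Finset.sum_add_distrib, ← Finset.mul_sum] at h1
  linarith

end

/-! ### Numbers of pulls and tracking -/

section

variable {K : ℕ}

lemma pulls_succ (a : ℕ → Fin K) (t : ℕ) (b : Fin K) :
    pulls a (t + 1) b = pulls a t b + if a (t + 1) = b then 1 else 0 := by
  rw [pulls, ← Finset.insert_Icc_right_eq_Icc_add_one (by omega), Finset.filter_insert]
  split_ifs with h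
  · rw [Finset.card_insert_of_notMem (by simp), pulls]
  · rw [pulls, add_zero]

lemma pulls_mono (a : ℕ → Fin K) {s t : ℕ} (h : s ≤ t) (b : Fin K) : pulls a s b ≤ pulls a t b :=
  Finset.card_le_card (Finset.filter_subset_filter _ (Finset.Icc_subset_Icc_right h))

lemma sum_pulls (a : ℕ → Fin K) (t : ℕ) : ∑ b, pulls a t b = t := by
  simp only [pulls]
  rw [← Finset.card_eq_sum_card_fiberwise (fun _ _ => Finset.mem_coe.2 (Finset.mem_univ _))]
  simp

lemma pulls_le (a : ℕ → Fin K) (t : ℕ) (b : Fin K) : pulls a t b ≤ t :=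
  (Finset.single_le_sum (f := pulls a t) (fun _ _ => Nat.zero_le _) (Finset.mem_univ b)).trans_eq
    (sum_pulls a t)

lemma sum_unif [NeZero K] : ∑ b, unif K b = 1 := by
  rw [unif_eq_softmax_zero, sum_softmax]

variable {grad : (Fin K → ℝ) → (Fin K → ℝ) → Fin K → ℝ} {M : ℝ} {η γ : ℕ → ℝ}
  {a : ℕ → Fin K} {y : ℕ → ℝ} {wt : ℕ → Fin K → ℝ}

lemma IsRun.weights_mem [NeZero K] (h : IsRun grad M η γ a y wt) {s : ℕ} (hs : 1 ≤ s) :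
    wt s ∈ stdSimplex ℝ (Fin K) := by
  rcases le_or_gt s K with h1 | h1
  · rw [h.init_weights s hs h1, unif_eq_softmax_zero]
    exact softmax_mem_stdSimplex _
  · obtain ⟨t, rfl⟩ : ∃ t, s = t + 1 := ⟨s - 1, by omega⟩
    exact h.ascent_mem t (by omega)

lemma IsRun.sum_exploredWeights [NeZero K] (h : IsRun grad M η γ a y wt) {s : ℕ} (hs : 1 ≤ s) :
    ∑ b, exploredWeights γ wt s b = 1 := by
  unfold exploredWeights
  split_ifs with h1
  · exact sum_unif
  · rw [Finset.sum_add_distrib, ← Finset.mul_sum, ← Finset.mul_sum, sum_unif,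
      (h.weights_mem hs).2]
    ring

lemma le_exploredWeights (wt : ℕ → Fin K → ℝ) (hγ0 : ∀ s, 0 ≤ γ s) {s : ℕ} (hs : K < s) (b : Fin K) :
    (1 - γ (s - 1)) * wt s b ≤ exploredWeights γ wt s b := by
  rw [exploredWeights, if_neg (by omega)]
  have : 0 ≤ γ (s - 1) * unif K b := mul_nonneg (hγ0 _) (by simp [unif])
  linarith

lemma IsRun.unif_le_exploredWeights [NeZero K] (h : IsRun grad M η γ a y wt)
    (hγ1 : ∀ s, γ s ≤ 1) {s : ℕ} (hs : K < s) (b : Fin K) :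
    γ (s - 1) / K ≤ exploredWeights γ wt s b := by
  rw [exploredWeights, if_neg (by omega)]
  have : 0 ≤ (1 - γ (s - 1)) * wt s b :=
    mul_nonneg (by linarith [hγ1 (s - 1)]) ((h.weights_mem (by omega)).1 b)
  have h2 : γ (s - 1) * unif K b = γ (s - 1) / K := by rw [unif]; ring
  linarith

lemma IsRun.exploredWeights_nonneg [NeZero K] (h : IsRun grad M η γ a y wt)
    (hγ0 : ∀ s, 0 ≤ γ s) (hγ1 : ∀ s, γ s ≤ 1) {s : ℕ} (b : Fin K) :
    0 ≤ exploredWeights γ wt s b := by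
  rcases le_or_gt s K with h1 | h1
  · rw [exploredWeights, if_pos h1]
    simp [unif]
  · exact (div_nonneg (hγ0 _) (Nat.cast_nonneg K)).trans (h.unif_le_exploredWeights hγ1 h1 b)

/-- Before the pull of round `t + 1` the deficits of the arms sum to `(t + 1) - t = 1`, so the
largest is positive. An arm is therefore pulled only when it lags behind its cumulative weight, and
overshoots by less than one. -/
lemma IsRun.pulls_le_sum [NeZero K] (h : IsRun grad M η γ a y wt)
    (hγ0 : ∀ s, 0 ≤ γ s) (hγ1 : ∀ s, γ s ≤ 1) {t : ℕ} (ht : K ≤ t) (b : Fin K) :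
    (pulls a t b : ℝ) ≤ ∑ s ∈ Finset.Icc 1 t, exploredWeights γ wt s b + 1 := by
  have hK := natCast_arms_pos (K := K)
  induction t, ht using Nat.le_induction with
  | base =>
    have := Finset.sum_nonneg (s := Finset.Icc 1 K)
      fun s _ => h.exploredWeights_nonneg hγ0 hγ1 (s := s) b
    simp only [h.init_pulls b, Nat.cast_one]
    linarith
  | succ t ht ih =>
    have hpos : 0 < ∑ s ∈ Finset.Icc 1 (t + 1), exploredWeights γ wt s (a (t + 1))
        - (pulls a t (a (t + 1)) : ℝ) := by
      by_contra hcon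
      have h1 : ∑ b, (∑ s ∈ Finset.Icc 1 (t + 1), exploredWeights γ wt s b
          - (pulls a t b : ℝ)) ≤ 0 :=
        Finset.sum_nonpos fun c _ => (h.tracking t ht c).trans (not_lt.1 hcon)
      rw [Finset.sum_sub_distrib, Finset.sum_comm,
        Finset.sum_congr rfl fun s hs => h.sum_exploredWeights (Finset.mem_Icc.1 hs).1,
        ← Nat.cast_sum, sum_pulls] at h1
      simp at h1
      linarith
    rw [pulls_succ]
    split_ifs with hb
    · subst hb
      push_cast
      linarith
    · rw [add_zero, Finset.sum_Icc_succ_top (by omega)]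
      linarith [h.exploredWeights_nonneg hγ0 hγ1 (s := t + 1) b]

/-- Pulls and weights both total `t`, so an overshoot of at most one on each other arm bounds the
lag of `b`. -/
lemma IsRun.sum_le_pulls [NeZero K] (h : IsRun grad M η γ a y wt)
    (hγ0 : ∀ s, 0 ≤ γ s) (hγ1 : ∀ s, γ s ≤ 1) {t : ℕ} (ht : K ≤ t) (b : Fin K) :
    ∑ s ∈ Finset.Icc 1 t, exploredWeights γ wt s b ≤ pulls a t b + K := by
  have h1 : ∑ c ∈ Finset.univ.erase b, (pulls a t c : ℝ) ≤
      ∑ c ∈ Finset.univ.erase b, (∑ s ∈ Finset.Icc 1 t, exploredWeights γ wt s c + 1) :=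
    Finset.sum_le_sum fun c _ => h.pulls_le_sum hγ0 hγ1 ht c
  have h2 := Finset.add_sum_erase Finset.univ (fun c => (pulls a t c : ℝ)) (Finset.mem_univ b)
  have h3 := Finset.add_sum_erase Finset.univ
    (fun c => ∑ s ∈ Finset.Icc 1 t, exploredWeights γ wt s c + 1) (Finset.mem_univ b)
  rw [← Nat.cast_sum Finset.univ, sum_pulls] at h2
  rw [Finset.sum_add_distrib (s := Finset.univ), Finset.sum_comm (s := Finset.univ),
    Finset.sum_congr rfl fun s hs => h.sum_exploredWeights (Finset.mem_Icc.1 hs).1] at h3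
  simp only [Finset.sum_const, Nat.card_Icc, add_tsub_cancel_right, nsmul_eq_mul, mul_one,
    Finset.card_univ, Fintype.card_fin] at h3
  linarith

/-- Forced exploration. -/
lemma IsRun.forced_exploration [NeZero K] {γ : ℕ → ℝ} (hγ : γ = fun t : ℕ => 1 / (4 * √(t : ℝ)))
    (h : IsRun grad M η γ a y wt) {t : ℕ} (ht : K ≤ t) (b : Fin K) :
    ((t : ℝ) - K) / (4 * K * √t) - K ≤ pulls a t b := by
  have hK := natCast_arms_pos (K := K)
  have hK1 : 1 ≤ K := Nat.one_le_iff_ne_zero.2 (NeZero.ne K)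
  have hγ0 : ∀ s, 0 ≤ γ s := fun s => by rw [hγ]; positivity
  have hγ1 : ∀ s, γ s ≤ 1 := fun s => by
    rw [hγ]
    rcases Nat.eq_zero_or_pos s with rfl | hs
    · simp
    · have : (1 : ℝ) ≤ √s := Real.one_le_sqrt.2 (by exact_mod_cast hs)
      rw [div_le_one (by positivity)]
      linarith
  have h1 := h.sum_le_pulls hγ0 hγ1 ht b
  have hsub : Finset.Ioc K t ⊆ Finset.Icc 1 t := fun s hs => by
    simp only [Finset.mem_Ioc, Finset.mem_Icc] at hs ⊢
    omega
  -- After round `K` the uniform part alone contributes `γ (s - 1) / K ≥ 1 / (4 K √t)` per round.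
  have h2 : ∑ s ∈ Finset.Ioc K t, (1 / (4 * K * √t) : ℝ) ≤
      ∑ s ∈ Finset.Icc 1 t, exploredWeights γ wt s b := by
    refine le_trans (Finset.sum_le_sum fun s hs => ?_)
      (Finset.sum_le_sum_of_subset_of_nonneg hsub fun s _ _ => h.exploredWeights_nonneg hγ0 hγ1 b)
    rw [Finset.mem_Ioc] at hs
    refine le_trans ?_ (h.unif_le_exploredWeights hγ1 hs.1 b)
    rw [hγ]
    have hs1 : (0 : ℝ) < ((s - 1 : ℕ) : ℝ) := by exact_mod_cast (by omega : 0 < s - 1)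
    have hs2 : ((s - 1 : ℕ) : ℝ) ≤ t := by exact_mod_cast (by omega : s - 1 ≤ t)
    have hs3 := Real.sqrt_pos.2 hs1
    have hs4 := Real.sqrt_le_sqrt hs2
    rw [div_div]
    refine one_div_le_one_div_of_le (by positivity) ?_
    nlinarith
  rw [Finset.sum_const, Nat.card_Ioc, nsmul_eq_mul, Nat.cast_sub ht] at h2
  calc ((t : ℝ) - K) / (4 * K * √t) - K = ((t : ℝ) - K) * (1 / (4 * K * √t)) - K := by ring
    _ ≤ _ := by linarith

end

/-! ### Weighted costs -/

/-- The cost `∑ a, w a * d(μ a, lam a)` whose infimum is `infCost`. -/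
noncomputable def cost {K : ℕ} (w μ lam : Fin K → ℝ) : ℝ := ∑ a, w a * gaussDiv (μ a) (lam a)

section

variable {K : ℕ} {I : Type*}

lemma gaussDiv_nonneg (x y : ℝ) : 0 ≤ gaussDiv x y := by unfold gaussDiv; positivity

lemma cost_nonneg {w : Fin K → ℝ} (hw : ∀ a, 0 ≤ w a) (μ lam : Fin K → ℝ) : 0 ≤ cost w μ lam :=
  Finset.sum_nonneg fun a _ => mul_nonneg (hw a) (gaussDiv_nonneg _ _)

lemma cost_mono {v w : Fin K → ℝ} (h : ∀ a, v a ≤ w a) (μ lam : Fin K → ℝ) :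
    cost v μ lam ≤ cost w μ lam :=
  Finset.sum_le_sum fun a _ => mul_le_mul_of_nonneg_right (h a) (gaussDiv_nonneg _ _)

lemma cost_const_mul (c : ℝ) (w μ lam : Fin K → ℝ) :
    cost (fun a => c * w a) μ lam = c * cost w μ lam := by
  simp only [cost, Finset.mul_sum, mul_assoc]

lemma cost_sum {ι : Type*} (s : Finset ι) (w : ι → Fin K → ℝ) (μ lam : Fin K → ℝ) :
    cost (fun a => ∑ i ∈ s, w i a) μ lam = ∑ i ∈ s, cost (w i) μ lam := by
  simp only [cost, Finset.sum_mul]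
  rw [Finset.sum_comm]

lemma infCost_le {w μ lam : Fin K → ℝ} {B : Set (Fin K → ℝ)} (h : lam ∈ B) :
    infCost w μ B ≤ ENNReal.ofReal (cost w μ lam) :=
  iInf₂_le (f := fun lam (_ : lam ∈ B) => ENNReal.ofReal (∑ a, w a * gaussDiv (μ a) (lam a)))
    lam h

lemma le_infCost {w μ : Fin K → ℝ} {B : Set (Fin K → ℝ)} {c : ℝ}
    (h : ∀ lam ∈ B, c ≤ cost w μ lam) : ENNReal.ofReal c ≤ infCost w μ B :=
  le_iInf₂ fun lam hl => ENNReal.ofReal_le_ofReal (h lam hl)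

lemma infCost_mono_set (w μ : Fin K → ℝ) {B C : Set (Fin K → ℝ)} (h : B ⊆ C) :
    infCost w μ C ≤ infCost w μ B :=
  biInf_mono fun _ hl => h hl

lemma infCost_eq_zero {w μ : Fin K → ℝ} {B : Set (Fin K → ℝ)} (h : μ ∈ B) :
    infCost w μ B = 0 := by
  refine le_antisymm ((infCost_le h).trans_eq ?_) bot_le
  simp [cost, gaussDiv]

/-- Changing the means in a cost, for weights on the simplex. -/
lemma cost_change_means {w : Fin K → ℝ} (hw : w ∈ stdSimplex ℝ (Fin K)) {μ ν : Fin K → ℝ}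
    {ε ξ : ℝ} (hε : 0 < ε) (hξ : ∀ a, |μ a - ν a| ≤ ξ) (hξε : (1 + 1 / ε) * (ξ ^ 2 / 2) ≤ ε)
    (lam : Fin K → ℝ) : (cost w μ lam - ε) / (1 + ε) ≤ cost w ν lam := by
  rw [div_le_iff₀ (by positivity), sub_le_iff_le_add]
  have h1 : ∀ a, w a * gaussDiv (μ a) (lam a) ≤
      w a * gaussDiv (ν a) (lam a) * (1 + ε) + w a * ε := by
    intro a
    rw [mul_assoc, ← mul_add]
    refine mul_le_mul_of_nonneg_left ?_ (hw.1 a)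
    have h2 : (μ a - ν a) ^ 2 ≤ ξ ^ 2 := sq_le_sq' (abs_le.1 (hξ a)).1 (abs_le.1 (hξ a)).2
    have h3 : (1 + 1 / ε) * ((μ a - ν a) ^ 2 / 2) ≤ ε := le_trans (by gcongr) hξε
    -- Young's inequality, exhibited as a perfect square. The loss is multiplicative in the cost
    -- because `lam` is unrestricted, so no additive error would be uniform.
    have h4 : (μ a - lam a) ^ 2 / 2 ≤
        (ν a - lam a) ^ 2 / 2 * (1 + ε) + (1 + 1 / ε) * ((μ a - ν a) ^ 2 / 2) := by
      have h5 : 0 ≤ (ε * (ν a - lam a) - (μ a - ν a)) ^ 2 / (2 * ε) := by positivity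
      have h6 : (ε * (ν a - lam a) - (μ a - ν a)) ^ 2 / (2 * ε) =
          (ν a - lam a) ^ 2 / 2 * (1 + ε) + (1 + 1 / ε) * ((μ a - ν a) ^ 2 / 2)
            - (μ a - lam a) ^ 2 / 2 := by
        field_simp
        ring
      linarith
    unfold gaussDiv
    linarith
  calc cost w μ lam ≤ ∑ a, (w a * gaussDiv (ν a) (lam a) * (1 + ε) + w a * ε) :=
        Finset.sum_le_sum fun a _ => h1 a
    _ = _ := by rw [Finset.sum_add_distrib, ← Finset.sum_mul, ← Finset.sum_mul, hw.2, one_mul, cost]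

lemma mem_alt {S : I → Set (Fin K → ℝ)} {μ lam : Fin K → ℝ} :
    lam ∈ alt S μ ↔ ∃ i, μ ∉ S i ∧ lam ∈ S i := by
  simp [alt]

lemma alt_eq_of_mem {S : I → Set (Fin K → ℝ)} (hdisj : ∀ i j, i ≠ j → Disjoint (S i) (S j))
    {i : I} {μ ν : Fin K → ℝ} (hμ : μ ∈ S i) (hν : ν ∈ S i) : alt S μ = alt S ν := by
  have key : ∀ μ ∈ S i, ∀ j, μ ∉ S j ↔ j ≠ i := fun μ hμ j =>
    ⟨fun h hj => h (hj ▸ hμ), fun h hj => (hdisj j i h).le_bot ⟨hj, hμ⟩⟩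
  ext lam
  simp only [mem_alt, key μ hμ, key ν hν]

lemma alt_nonempty {S : I → Set (Fin K → ℝ)} (hdisj : ∀ i j, i ≠ j → Disjoint (S i) (S j))
    (hne : ∃ i j, i ≠ j ∧ (S i).Nonempty ∧ (S j).Nonempty) (μ : Fin K → ℝ) :
    (alt S μ).Nonempty := by
  obtain ⟨i, j, hij, ⟨x, hx⟩, ⟨z, hz⟩⟩ := hne
  by_cases h : μ ∈ S i
  · exact ⟨z, mem_alt.2 ⟨j, fun hj => (hdisj i j hij).le_bot ⟨h, hj⟩, hz⟩⟩
  · exact ⟨x, mem_alt.2 ⟨i, h, hx⟩⟩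

lemma objective_le {S : I → Set (Fin K → ℝ)} {w μ lam : Fin K → ℝ} (hw : ∀ a, 0 ≤ w a)
    (h : lam ∈ alt S μ) : objective S w μ ≤ cost w μ lam :=
  ENNReal.toReal_le_of_le_ofReal (cost_nonneg hw μ lam) (infCost_le h)

lemma le_objective {S : I → Set (Fin K → ℝ)} {w μ : Fin K → ℝ} (hne : (alt S μ).Nonempty)
    {c : ℝ} (h : ∀ lam ∈ alt S μ, c ≤ cost w μ lam) : c ≤ objective S w μ := by
  obtain ⟨lam, hl⟩ := hne
  exact (ENNReal.ofReal_le_iff_le_toReal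
    (ne_top_of_le_ne_top ENNReal.ofReal_ne_top (infCost_le hl))).1 (le_infCost h)

/-- The objective is nondecreasing in the weights: test the inequality with one more unit on `a`.
This covers the rounds where the empirical means are far from `μ` and the boundedness assumption
says nothing. -/
lemma IsSubgradient.nonneg {S : I → Set (Fin K → ℝ)} {w g μ : Fin K → ℝ}
    (hg : IsSubgradient (fun v => objective S v μ) w g) (hw : ∀ a, 0 ≤ w a)
    (hne : (alt S μ).Nonempty) (a : Fin K) : 0 ≤ g a := by
  classical
  have hv : ∀ b, w b ≤ w b + if b = a then 1 else 0 := fun b => by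
    split_ifs <;> simp
  have h1 := hg (fun b => w b + if b = a then 1 else 0) fun b => (hw b).trans (hv b)
  have h2 : objective S w μ ≤ objective S (fun b => w b + if b = a then 1 else 0) μ :=
    le_objective hne fun lam hl => (objective_le hw hl).trans (cost_mono hv μ lam)
  simp at h1
  linarith

end

/-! ### Regret of the mirror ascent -/

section

variable {K : ℕ} [NeZero K] {I : Type*} {S : I → Set (Fin K → ℝ)}
  {grad : (Fin K → ℝ) → (Fin K → ℝ) → Fin K → ℝ} {M : ℝ} {η γ : ℕ → ℝ}
  {a : ℕ → Fin K} {y : ℕ → ℝ} {wt : ℕ → Fin K → ℝ}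

/-- The mirror objective is a linear function minus `kl`, so its maximiser is explicit. In
particular its coordinates are positive, as the gradient selection requires. -/
lemma IsRun.weights_eq_softmax (h : IsRun grad M η γ a y wt) {s : ℕ} (hs : K < s) :
    wt s = softmax (fun b => η s *
      ∑ r ∈ Finset.Ico K s, clip M r (grad (wt r) (empMean a y r)) b) := by
  obtain ⟨t, rfl⟩ : ∃ t, s = t + 1 := ⟨s - 1, by omega⟩
  refine eq_softmax_of_isMaxOn (h.ascent_mem t (by omega)) _ ?_
  convert h.ascent_max t (by omega) using 2 with v
  rw [mirrorObjective, Finset.sum_comm, Finset.mul_sum]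
  congr 1
  refine Finset.sum_congr rfl fun b _ => ?_
  rw [← Finset.mul_sum, Finset.Ico_add_one_right_eq_Icc]
  ring

lemma IsRun.weights_pos (h : IsRun grad M η γ a y wt) {s : ℕ} (hs : 1 ≤ s) (b : Fin K) :
    0 < wt s b := by
  rcases le_or_gt s K with h1 | h1
  · rw [h.init_weights s hs h1, unif_eq_softmax_zero]
    exact softmax_pos _ _
  · rw [h.weights_eq_softmax h1]
    exact softmax_pos _ _

lemma IsRun.isSubgradient (hgrad : IsSubgradientSelection S grad)
    (h : IsRun grad M η γ a y wt) {s : ℕ} (hs : 1 ≤ s) (ν : Fin K → ℝ) :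
    IsSubgradient (fun v => objective S v ν) (wt s) (grad (wt s) ν) :=
  hgrad ν _ (h.weights_mem hs) (h.weights_pos hs)

lemma IsRun.clip_nonneg (hdisj : ∀ i j, i ≠ j → Disjoint (S i) (S j))
    (hne : ∃ i j, i ≠ j ∧ (S i).Nonempty ∧ (S j).Nonempty)
    (hgrad : IsSubgradientSelection S grad) (hM : 0 < M)
    (h : IsRun grad M η γ a y wt) {s : ℕ} (hs : 1 ≤ s) (b : Fin K) :
    0 ≤ clip M s (grad (wt s) (empMean a y s)) b :=
  le_min ((h.isSubgradient hgrad hs _).nonneg (fun c => (h.weights_pos hs c).le)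
    (alt_nonempty hdisj hne _) b) (by positivity)

/-- Rounds `K, …, s₀ - 1` enter only as initial gains, bounded by the clipping level. From `s₀` on,
`L ≤ M √s₀` makes the clipping inactive, so the gains are true sub-gradients and linear regret
dominates regret in the objective; `L ≤ √s₀` is the step-size condition. -/
lemma IsRun.regret_le (hdisj : ∀ i j, i ≠ j → Disjoint (S i) (S j))
    (hne : ∃ i j, i ≠ j ∧ (S i).Nonempty ∧ (S j).Nonempty)
    (hgrad : IsSubgradientSelection S grad) (hM : 0 < M)
    (h : IsRun grad M (fun t => 1 / √(t : ℝ)) γ a y wt) {s₀ T : ℕ} (hs₀ : K < s₀) (hT : s₀ ≤ T)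
    {L : ℝ} (hL : ∀ s, s₀ ≤ s → s ≤ T → ∀ b, grad (wt s) (empMean a y s) b ≤ L)
    (hLM : L ≤ M * √s₀) (hL1 : L ≤ √s₀) {v : Fin K → ℝ} (hv : v ∈ stdSimplex ℝ (Fin K)) :
    ∑ s ∈ Finset.Icc s₀ T, (objective S v (empMean a y s) - objective S (wt s) (empMean a y s)) ≤
      Real.log K * √(T + 1 : ℝ) + M * s₀ * √s₀ + L ^ 2 * (T / √s₀) := by
  have hK1 : 1 ≤ K := Nat.one_le_iff_ne_zero.2 (NeZero.ne K)
  have hs₀pos : (0 : ℝ) < √s₀ := Real.sqrt_pos.2 (by exact_mod_cast (by omega : 0 < s₀))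
  have hclip0 : ∀ s, 1 ≤ s → ∀ b, 0 ≤ clip M s (grad (wt s) (empMean a y s)) b :=
    fun s hs b => h.clip_nonneg hdisj hne hgrad hM hs b
  have hclip : ∀ s, s₀ ≤ s → s ≤ T → ∀ b,
      clip M s (grad (wt s) (empMean a y s)) b = grad (wt s) (empMean a y s) b := by
    intro s h1 h2 b
    refine min_eq_left ((hL s h1 h2 b).trans (hLM.trans ?_))
    gcongr
  have hreg := expWeights_regret (K := K) (fun t : ℕ => 1 / √(t : ℝ))
    (fun s hs => by have : (0 : ℝ) < s := by exact_mod_cast hs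
                    positivity)
    (fun s hs => by
      have : (0 : ℝ) < s := by exact_mod_cast hs
      exact one_div_le_one_div_of_le (by positivity) (Real.sqrt_le_sqrt (by simp)))
    (fun s b => ∑ r ∈ Finset.Ico K s, clip M r (grad (wt r) (empMean a y r)) b)
    (fun s => clip M s (grad (wt s) (empMean a y s))) wt (s₀ := s₀) (T := T) (by omega) hT
    (fun s hs b => Finset.sum_Ico_succ_top (by omega) _)
    (fun s hs => h.weights_eq_softmax (by omega))
    (B := M * s₀ * √s₀) (L := L)
    (fun b => Finset.sum_nonneg fun r hr => hclip0 r (by rw [Finset.mem_Ico] at hr; omega) b)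
    (fun b => by
      calc ∑ r ∈ Finset.Ico K s₀, clip M r (grad (wt r) (empMean a y r)) b
          ≤ ∑ r ∈ Finset.Ico K s₀, M * √s₀ := by
            refine Finset.sum_le_sum fun r hr => (min_le_right _ _).trans ?_
            have : r ≤ s₀ := (Finset.mem_Ico.1 hr).2.le
            gcongr
        _ = ((s₀ - K : ℕ) : ℝ) * (M * √s₀) := by simp
        _ ≤ s₀ * (M * √s₀) := by
            gcongr
            exact Nat.sub_le _ _
        _ = M * s₀ * √s₀ := by ring)
    (fun s h1 _ b => hclip0 s (by omega) b)
    (fun s h1 h2 b => by rw [hclip s h1 h2]; exact hL s h1 h2 b)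
    (by
      rw [one_div, inv_mul_le_iff₀ hs₀pos, mul_one]
      exact hL1) hv
  calc _ ≤ ∑ s ∈ Finset.Icc s₀ T, ∑ b, clip M s (grad (wt s) (empMean a y s)) b *
        (v b - wt s b) := by
        refine Finset.sum_le_sum fun s hs => ?_
        rw [Finset.mem_Icc] at hs
        have := h.isSubgradient hgrad (s := s) (by omega) (empMean a y s) v hv.1
        rw [Finset.sum_congr rfl fun b _ => by rw [hclip s hs.1 hs.2 b]]
        simp only at this
        linarith
    _ ≤ _ := hreg
    _ ≤ _ := by
        have h1 : ∑ s ∈ Finset.Icc s₀ T, 1 / √(s : ℝ) ≤ T / √s₀ := by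
          calc _ ≤ ∑ s ∈ Finset.Icc s₀ T, 1 / √(s₀ : ℝ) := by
                refine Finset.sum_le_sum fun s hs => one_div_le_one_div_of_le hs₀pos ?_
                exact Real.sqrt_le_sqrt (by exact_mod_cast (Finset.mem_Icc.1 hs).1)
            _ = ((T + 1 - s₀ : ℕ) : ℝ) * (1 / √(s₀ : ℝ)) := by simp
            _ ≤ T * (1 / √(s₀ : ℝ)) := by
                gcongr
                omega
            _ = _ := by ring
        have h2 : Real.log K / (1 / √((T + 1 : ℕ) : ℝ)) = Real.log K * √(T + 1 : ℝ) := by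
          push_cast
          field_simp
        rw [h2]
        gcongr

/-- Lower bound on the accumulated cost when the empirical means are close to `μ` and the
gradients are bounded in rounds `s₀, …, T`. -/
lemma IsRun.le_cost_pulls (hdisj : ∀ i j, i ≠ j → Disjoint (S i) (S j))
    (hne : ∃ i j, i ≠ j ∧ (S i).Nonempty ∧ (S j).Nonempty)
    (hgrad : IsSubgradientSelection S grad) (hM : 0 < M)
    (h : IsRun grad M (fun t => 1 / √(t : ℝ)) (fun t => 1 / (4 * √(t : ℝ))) a y wt)
    {i : I} {μ : Fin K → ℝ} (hμ : μ ∈ S i) {v : Fin K → ℝ} (hv : v ∈ stdSimplex ℝ (Fin K))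
    {ε ξ c L : ℝ} (hε : 0 < ε) (hε1 : ε < 1) (hc : ε ≤ c)
    (hvc : ∀ lam ∈ alt S μ, c ≤ cost v μ lam)
    (hξε : (1 + 1 / ε) * ((2 * ξ) ^ 2 / 2) ≤ ε) {s₀ T : ℕ} (hs₀ : K + 1 < s₀) (hT : s₀ ≤ T)
    (hmean : ∀ s, s₀ ≤ s → s ≤ T → ∀ b, |empMean a y s b - μ b| < ξ)
    (hmem : ∀ s, s₀ ≤ s → s ≤ T → empMean a y s ∈ S i)
    (hL : ∀ s, s₀ ≤ s → s ≤ T → ∀ b, grad (wt s) (empMean a y s) b ≤ L)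
    (hLM : L ≤ M * √s₀) (hL1 : L ≤ √s₀) (hγε : 1 ≤ 4 * ε * √(s₀ - 1 : ℝ))
    (hNε : (1 - ε) * K ≤ ε * ((T - K) / (4 * K * √T) - K))
    (hn : (s₀ : ℝ) - 1 ≤ ε * T)
    (hreg : Real.log K * √(T + 1 : ℝ) + M * s₀ * √s₀ + L ^ 2 * (T / √s₀) ≤ ε * T)
    {lam : Fin K → ℝ} (hlam : lam ∈ alt S μ) :
    (1 - ε) ^ 2 / (1 + ε) * ((1 - ε) * ((c - ε) / (1 + ε)) - 2 * ε) * T ≤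
      cost (fun b => (pulls a T b : ℝ)) (empMean a y T) lam := by
  have hK := natCast_arms_pos (K := K)
  set m := fun s => empMean a y s with hm
  have hξ0 : ∀ s, s₀ ≤ s → s ≤ T → ∀ b, |m s b - m T b| ≤ 2 * ξ := by
    intro s h1 h2 b
    have h3 := abs_sub_lt_iff.1 (hmean s h1 h2 b)
    have h4 := abs_sub_lt_iff.1 (hmean T hT le_rfl b)
    exact abs_le.2 ⟨by simp only [hm]; linarith, by simp only [hm]; linarith⟩
  have halt : ∀ s, s₀ ≤ s → s ≤ T → alt S (m s) = alt S μ := fun s h1 h2 =>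
    alt_eq_of_mem hdisj (hmem s h1 h2) hμ
  have hγ0 : ∀ s : ℕ, 0 ≤ 1 / (4 * √(s : ℝ)) := fun s => by positivity
  have hγ1 : ∀ s : ℕ, 1 / (4 * √(s : ℝ)) ≤ 1 := fun s => by
    rcases Nat.eq_zero_or_pos s with rfl | hs
    · simp
    · have : (1 : ℝ) ≤ √s := Real.one_le_sqrt.2 (by exact_mod_cast hs)
      rw [div_le_one (by positivity)]
      linarith
  -- weights against pulls
  have hpulls : ∀ b, (1 - ε) ^ 2 * ∑ s ∈ Finset.Icc s₀ T, wt s b ≤ pulls a T b := by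
    intro b
    have h1 := h.forced_exploration rfl (t := T) (by omega) b
    have h2 := h.sum_le_pulls hγ0 hγ1 (t := T) (by omega) b
    have h3 : (1 - ε) * ∑ s ∈ Finset.Icc s₀ T, wt s b ≤
        ∑ s ∈ Finset.Icc 1 T, exploredWeights (fun t : ℕ => 1 / (4 * √(t : ℝ))) wt s b := by
      rw [Finset.mul_sum]
      refine le_trans (Finset.sum_le_sum fun s hs => ?_)
        (Finset.sum_le_sum_of_subset_of_nonneg
          (Finset.Icc_subset_Icc_left (by omega : 1 ≤ s₀))
          fun s _ _ => h.exploredWeights_nonneg hγ0 hγ1 b)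
      rw [Finset.mem_Icc] at hs
      refine le_trans ?_ (le_exploredWeights wt hγ0 (by omega) b)
      refine mul_le_mul_of_nonneg_right ?_ (h.weights_pos (by omega) b).le
      have h4 : √(s₀ - 1 : ℝ) ≤ √((s - 1 : ℕ) : ℝ) := by
        refine Real.sqrt_le_sqrt ?_
        rw [Nat.cast_sub (by omega)]
        have : (s₀ : ℝ) ≤ s := by exact_mod_cast hs.1
        simpa using this
      have h5 : 0 < √((s - 1 : ℕ) : ℝ) :=
        Real.sqrt_pos.2 (by exact_mod_cast (by omega : 0 < s - 1))
      have h6 : 1 / (4 * √((s - 1 : ℕ) : ℝ)) ≤ ε := by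
        rw [div_le_iff₀ (by positivity)]
        nlinarith
      linarith
    -- By forced exploration the tracking error `K` is a small fraction of the pulls of every arm.
    have h4 : ε * (((T : ℝ) - K) / (4 * K * √T) - K) ≤ ε * pulls a T b := by gcongr
    calc (1 - ε) ^ 2 * ∑ s ∈ Finset.Icc s₀ T, wt s b
        = (1 - ε) * ((1 - ε) * ∑ s ∈ Finset.Icc s₀ T, wt s b) := by ring
      _ ≤ (1 - ε) * (pulls a T b + K) :=
          mul_le_mul_of_nonneg_left (h3.trans h2) (by linarith)
      _ ≤ pulls a T b := by linarith
  -- objectives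
  have hobj : ∀ s ∈ Finset.Icc s₀ T, (objective S (wt s) (m s) - ε) / (1 + ε) ≤
      cost (wt s) (m T) lam := by
    intro s hs
    rw [Finset.mem_Icc] at hs
    refine le_trans ?_ (cost_change_means (h.weights_mem (by omega)) hε
      (hξ0 s hs.1 hs.2) hξε lam)
    gcongr
    exact objective_le (fun b => (h.weights_pos (by omega) b).le)
      (by rw [halt s hs.1 hs.2]; exact hlam)
  have hobjv : ∀ s ∈ Finset.Icc s₀ T, (c - ε) / (1 + ε) ≤ objective S v (m s) := by
    intro s hs
    rw [Finset.mem_Icc] at hs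
    refine le_objective (alt_nonempty hdisj hne _) fun l hl => ?_
    rw [halt s hs.1 hs.2] at hl
    have hξpos : 0 ≤ ξ := (abs_nonneg _).trans (hmean T hT le_rfl 0).le
    refine le_trans ?_ (cost_change_means hv hε (μ := μ) (ν := m s) (ξ := 2 * ξ) (fun b => ?_)
      hξε l)
    · have := hvc l hl
      gcongr
    · rw [abs_sub_comm]
      linarith [hmean s hs.1 hs.2 b]
  have hregret := h.regret_le hdisj hne hgrad hM (by omega) hT hL hLM hL1 hv
  rw [Finset.sum_sub_distrib] at hregret
  have hcard : (1 - ε) * T ≤ ((Finset.Icc s₀ T).card : ℝ) := by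
    rw [Nat.card_Icc, Nat.cast_sub (by omega)]
    push_cast
    linarith
  have hcard' : ((Finset.Icc s₀ T).card : ℝ) ≤ T := by
    rw [Nat.card_Icc]
    exact_mod_cast (by omega : T + 1 - s₀ ≤ T)
  have hsumv : (1 - ε) * T * ((c - ε) / (1 + ε)) ≤ ∑ s ∈ Finset.Icc s₀ T, objective S v (m s) := by
    calc _ ≤ ((Finset.Icc s₀ T).card : ℝ) * ((c - ε) / (1 + ε)) := by
          refine mul_le_mul_of_nonneg_right hcard (div_nonneg (by linarith) (by linarith))
      _ = ∑ s ∈ Finset.Icc s₀ T, (c - ε) / (1 + ε) := by simp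
      _ ≤ _ := Finset.sum_le_sum hobjv
  have hεT : ε * ((Finset.Icc s₀ T).card : ℝ) ≤ ε * T := by gcongr
  -- Sources of the losses: `(1 - ε) ^ 2` is tracking and exploration, the outer `1 + ε` is the
  -- passage to the means at time `T`, the inner `1 - ε` is the omission of rounds before `s₀`, and
  -- `2 ε` is the regret plus the additive errors of changing means.
  calc (1 - ε) ^ 2 / (1 + ε) * ((1 - ε) * ((c - ε) / (1 + ε)) - 2 * ε) * T
      = (1 - ε) ^ 2 * (((1 - ε) * T * ((c - ε) / (1 + ε)) - 2 * ε * T) / (1 + ε)) := by ring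
    _ ≤ (1 - ε) ^ 2 * ((∑ s ∈ Finset.Icc s₀ T, (objective S (wt s) (m s) - ε)) / (1 + ε)) := by
        gcongr
        rw [Finset.sum_sub_distrib, Finset.sum_const, nsmul_eq_mul]
        linarith
    _ ≤ (1 - ε) ^ 2 * ∑ s ∈ Finset.Icc s₀ T, cost (wt s) (m T) lam := by
        rw [Finset.sum_div]
        gcongr with s hs
        exact hobj s hs
    _ = cost (fun b => (1 - ε) ^ 2 * ∑ s ∈ Finset.Icc s₀ T, wt s b) (m T) lam := by
        rw [cost_const_mul, cost_sum]
    _ ≤ _ := cost_mono hpulls _ _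

/-- The squared index `s₀ = √T + 1` is between `T` and `4 T`, so that all error terms are
controlled once `s₀` is large. -/
lemma exists_horizon_conditions (K : ℕ) [NeZero K] {M : ℝ} (hM : 0 < M) (L : ℝ) {ε : ℝ}
    (hε : 0 < ε) : ∃ T₀ : ℕ, ∀ T ≥ T₀, ∃ s₀ : ℕ, T ≤ s₀ ^ 2 ∧ K + 1 < s₀ ∧ s₀ ≤ T ∧
      L ≤ M * √s₀ ∧ L ≤ √s₀ ∧ 1 ≤ 4 * ε * √(s₀ - 1 : ℝ) ∧
      (1 - ε) * K ≤ ε * ((T - K) / (4 * K * √T) - K) ∧ (s₀ : ℝ) - 1 ≤ ε * T ∧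
      Real.log K * √(T + 1 : ℝ) + M * s₀ * √s₀ + L ^ 2 * (T / √s₀) ≤ ε * T := by
  have hK := natCast_arms_pos (K := K)
  have hlogK : 0 ≤ Real.log K := Real.log_natCast_nonneg K
  have hN : Tendsto (fun T : ℕ => (T : ℝ)) atTop atTop := tendsto_natCast_atTop_atTop
  have hsq : Tendsto (fun T : ℕ => √(T : ℝ)) atTop atTop := Real.tendsto_sqrt_atTop.comp hN
  have hsq1 : Tendsto (fun T : ℕ => √(T - 1 : ℝ)) atTop atTop :=
    Real.tendsto_sqrt_atTop.comp (tendsto_atTop_add_const_right _ (-1) hN)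
  have hs : Tendsto (fun T : ℕ => Nat.sqrt T + 1) atTop atTop := by
    refine tendsto_atTop_atTop.2 fun b => ⟨b ^ 2, fun T hT => ?_⟩
    exact (Nat.le_sqrt'.2 hT).trans (Nat.le_succ _)
  have hev : ∀ᶠ s₀ : ℕ in atTop, K + 1 < s₀ ∧ 4 ≤ s₀ ∧ L ≤ M * √(s₀ : ℝ) ∧ L ≤ √(s₀ : ℝ) ∧
      1 ≤ 4 * ε * √(s₀ - 1 : ℝ) ∧ 4 ≤ ε * s₀ ∧
      4 * Real.log K + 4 * M + L ^ 2 ≤ ε * √(s₀ : ℝ) := by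
    filter_upwards [eventually_gt_atTop (K + 1), eventually_ge_atTop 4,
      (hsq.const_mul_atTop hM).eventually_ge_atTop L, hsq.eventually_ge_atTop L,
      (hsq1.const_mul_atTop (by positivity : 0 < 4 * ε)).eventually_ge_atTop 1,
      (hN.const_mul_atTop hε).eventually_ge_atTop 4,
      (hsq.const_mul_atTop hε).eventually_ge_atTop (4 * Real.log K + 4 * M + L ^ 2)]
      with s h1 h2 h3 h4 h5 h6 h7 using ⟨h1, h2, h3, h4, h5, h6, h7⟩
  have hev2 : ∀ᶠ T : ℕ in atTop, (1 - ε) * K ≤ ε * ((T - K) / (4 * K * √T) - K) := by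
    filter_upwards [(hsq.const_mul_atTop (by positivity : 0 < ε / (8 * K))).eventually_ge_atTop
      ((1 - ε) * K + ε * K), eventually_ge_atTop (2 * K), eventually_gt_atTop 0] with T h1 h2 h3
    have h3' : (0 : ℝ) < T := by exact_mod_cast h3
    have h2' : (2 : ℝ) * K ≤ T := by exact_mod_cast h2
    have hsT : 0 < √(T : ℝ) := Real.sqrt_pos.2 h3'
    have h4 : √(T : ℝ) / (8 * K) ≤ (T - K) / (4 * K * √T) := by
      rw [div_le_div_iff₀ (by positivity) (by positivity)]
      have := Real.mul_self_sqrt h3'.le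
      calc √(T : ℝ) * (4 * K * √T) = 4 * K * (√(T : ℝ) * √T) := by ring
        _ = 4 * K * T := by rw [this]
        _ ≤ (T - K) * (8 * K) := by nlinarith
    have h5 : ε * (√(T : ℝ) / (8 * K)) ≤ ε * ((T - K) / (4 * K * √T)) := by gcongr
    have h6 : ε / (8 * K) * √(T : ℝ) = ε * (√(T : ℝ) / (8 * K)) := by ring
    linarith
  obtain ⟨T₀, hT₀⟩ := eventually_atTop.1 ((hs.eventually hev).and hev2)
  refine ⟨T₀, fun T hT => ?_⟩
  obtain ⟨⟨h1, h2, h3, h4, h5, h6, h7⟩, h8⟩ := hT₀ T hT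
  set s := Nat.sqrt T + 1 with hsdef
  have hTs : T < s ^ 2 := Nat.lt_succ_sqrt' T
  have hsT : (s - 1) ^ 2 ≤ T := Nat.sqrt_le' T
  have hs4 : s ^ 2 ≤ 4 * T := by
    have : s ≤ 2 * (s - 1) := by omega
    calc s ^ 2 ≤ (2 * (s - 1)) ^ 2 := Nat.pow_le_pow_left this 2
      _ = 4 * (s - 1) ^ 2 := by ring
      _ ≤ _ := by omega
  have hs4' : (s : ℝ) ^ 2 ≤ 4 * T := by exact_mod_cast hs4
  have hTs' : (T : ℝ) + 1 ≤ (s : ℝ) ^ 2 := by exact_mod_cast hTs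
  have hspos : (4 : ℝ) ≤ s := by exact_mod_cast h2
  have hsT' : s ≤ T := by nlinarith
  refine ⟨s, hTs.le, h1, hsT', h3, h4, h5, h8, ?_, ?_⟩
  · nlinarith
  · set q := √(s : ℝ)
    have hq : q ^ 2 = s := Real.sq_sqrt (by linarith)
    have hq1 : 1 ≤ q := Real.one_le_sqrt.2 (by linarith)
    have hTp : (0 : ℝ) ≤ T := Nat.cast_nonneg T
    -- Since `s₀ = q²` and `T < s₀² ≤ 4 T`, each of the three error terms is at most a constant
    -- times `T / q`, and `h7` bounds the sum of these constants by `ε q`.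
    have e1 : √(T + 1 : ℝ) ≤ 4 * T / q := by
      calc √(T + 1 : ℝ) ≤ s := Real.sqrt_le_iff.2 ⟨by linarith, hTs'⟩
        _ ≤ 4 * T / q := by
          rw [le_div_iff₀ (by positivity)]
          nlinarith
    have e2 : M * s * q ≤ 4 * M * T / q := by
      rw [le_div_iff₀ (by positivity)]
      calc M * s * q * q = M * s ^ 2 := by rw [← hq]; ring
        _ ≤ M * (4 * T) := by gcongr
        _ = _ := by ring
    calc Real.log K * √(T + 1 : ℝ) + M * s * q + L ^ 2 * (T / q)
        ≤ Real.log K * (4 * T / q) + 4 * M * T / q + L ^ 2 * (T / q) := by gcongr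
      _ = (4 * Real.log K + 4 * M + L ^ 2) * (T / q) := by ring
      _ ≤ ε * q * (T / q) := by gcongr
      _ = ε * T := by field_simp

/-- On runs whose empirical means are close to `μ` in rounds `t ≥ √T`, the accumulated cost at `T`
is at least `c T`, for every `c` below the value `c'` of some weights `v`. -/
lemma exists_radius_le_cost_pulls (hopen : ∀ i, IsOpen (S i))
    (hdisj : ∀ i j, i ≠ j → Disjoint (S i) (S j))
    (hne : ∃ i j, i ≠ j ∧ (S i).Nonempty ∧ (S j).Nonempty)
    (hgrad : IsSubgradientSelection S grad) (hbdd : BoundedSubgradients S grad) (hM : 0 < M)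
    {i : I} {μ : Fin K → ℝ} (hμ : μ ∈ S i) {v : Fin K → ℝ} (hv : v ∈ stdSimplex ℝ (Fin K))
    {c c' : ℝ} (hc : 0 < c) (hcc : c < c') (hvc : ∀ lam ∈ alt S μ, c' ≤ cost v μ lam) :
    ∃ ξ : ℝ, 0 < ξ ∧ ∃ T₀ : ℕ, ∀ (a : ℕ → Fin K) (y : ℕ → ℝ) (wt : ℕ → Fin K → ℝ),
      IsRun grad M (fun t => 1 / √(t : ℝ)) (fun t => 1 / (4 * √(t : ℝ))) a y wt →
      ∀ T ≥ T₀, (∀ t ≤ T, T ≤ t ^ 2 → ∀ b, |empMean a y t b - μ b| < ξ) →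
        ∀ lam ∈ alt S (empMean a y T),
          c * T ≤ cost (fun b => (pulls a T b : ℝ)) (empMean a y T) lam := by
  obtain ⟨κ, hκ, L, hL⟩ := hbdd μ (Set.mem_iUnion.2 ⟨i, hμ⟩)
  obtain ⟨r, hr, hball⟩ := Metric.isOpen_iff.1 (hopen i) μ hμ
  -- The factor obtained in `IsRun.le_cost_pulls` tends to `c'` as `ε → 0`, so a small `ε` leaves
  -- more than `c`. All choices precede the run, so `ξ` and `T₀` serve every run.
  have hlim : Tendsto (fun ε : ℝ => (1 - ε) ^ 2 / (1 + ε) *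
      ((1 - ε) * ((c' - ε) / (1 + ε)) - 2 * ε)) (𝓝[>] 0) (𝓝 c') := by
    have : ContinuousAt (fun ε : ℝ => (1 - ε) ^ 2 / (1 + ε) *
      ((1 - ε) * ((c' - ε) / (1 + ε)) - 2 * ε)) 0 := by
      fun_prop (disch := norm_num)
    have h2 := this.tendsto.mono_left (nhdsWithin_le_nhds (s := Set.Ioi 0))
    simpa using h2
  obtain ⟨ε, hε1, ⟨hε0, hεb⟩⟩ := ((hlim.eventually_const_lt hcc).and
    (Ioo_mem_nhdsGT (lt_min one_pos hc))).exists
  have hεc : ε < c := hεb.trans_le (min_le_right _ _)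
  have hεone : ε < 1 := hεb.trans_le (min_le_left _ _)
  have hlim2 : Tendsto (fun ξ : ℝ => (1 + 1 / ε) * ((2 * ξ) ^ 2 / 2)) (𝓝[>] 0) (𝓝 0) := by
    have : ContinuousAt (fun ξ : ℝ => (1 + 1 / ε) * ((2 * ξ) ^ 2 / 2)) 0 := by fun_prop
    have h2 := this.tendsto.mono_left (nhdsWithin_le_nhds (s := Set.Ioi 0))
    simpa using h2
  obtain ⟨ξ, hξε, ⟨hξ0, hξb⟩⟩ := ((hlim2.eventually_le_const hε0).and
    (Ioo_mem_nhdsGT (lt_min hκ hr))).exists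
  obtain ⟨T₀, hT₀⟩ := exists_horizon_conditions K hM L hε0
  refine ⟨ξ, hξ0, T₀, fun a y wt h T hT hmean lam hlam => ?_⟩
  obtain ⟨s₀, g1, g2, g3, g4, g5, g6, g7, g8, g9⟩ := hT₀ T hT
  have hmean' : ∀ s, s₀ ≤ s → s ≤ T → ∀ b, |empMean a y s b - μ b| < ξ := fun s h1 h2 =>
    hmean s h2 (g1.trans (Nat.pow_le_pow_left h1 2))
  have hdist : ∀ s, s₀ ≤ s → s ≤ T → dist (empMean a y s) μ < min κ r := fun s h1 h2 =>
    ((dist_pi_lt_iff hξ0).2 fun b => hmean' s h1 h2 b).trans hξb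
  have hmem : ∀ s, s₀ ≤ s → s ≤ T → empMean a y s ∈ S i := fun s h1 h2 =>
    hball ((hdist s h1 h2).trans_le (min_le_right _ _))
  rw [alt_eq_of_mem hdisj (hmem T g3 le_rfl) hμ] at hlam
  refine le_trans ?_ (h.le_cost_pulls hdisj hne hgrad hM hμ hv hε0 hεone (hεc.trans hcc).le hvc
    hξε g2 g3 hmean' hmem (L := L) (fun s h1 h2 b => ?_) g4 g5 g6 g7 g8 g9 hlam)
  · gcongr
  · exact (hL _ (h.weights_mem (by omega)) (h.weights_pos (by omega)) _
      ((hdist s h1 h2).trans_le (min_le_left _ _)) b).2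

end

/-! ### Exponential martingales -/

/-- A maximal inequality for nonnegative martingales, in integrated form. -/
lemma measure_exists_ge_le {Ω : Type*} [mΩ : MeasurableSpace Ω] {P : Measure Ω}
    (ℱ : Filtration ℕ mΩ) (f : ℕ → Ω → ℝ≥0∞) (hf : ∀ t, Measurable[ℱ t] (f t))
    (hstep : ∀ t B, MeasurableSet[ℱ t] B → ∫⁻ ω in B, f (t + 1) ω ∂P = ∫⁻ ω in B, f t ω ∂P)
    (h0 : ∫⁻ ω, f 0 ω ∂P ≤ 1) (c : ℝ≥0∞) : c * P {ω | ∃ t, c ≤ f t ω} ≤ 1 := by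
  set E : ℕ → Set Ω := fun t => {ω | c ≤ f t ω}
  have hE : ∀ s t, s ≤ t → MeasurableSet[ℱ t] (E s) := fun s t hst =>
    ℱ.mono hst _ (hf s measurableSet_Ici)
  -- `B t` is the event that `t` is the first passage above `c`. The martingale property carries its
  -- integral to a common later time `n`, where the disjoint pieces share total mass at most one.
  set B : ℕ → Set Ω := fun t => E t ∩ ⋂ s ∈ Finset.range t, (E s)ᶜ
  have hB : ∀ t, MeasurableSet[ℱ t] (B t) := fun t =>
    @MeasurableSet.inter _ (ℱ t) _ _ (hE t t le_rfl)
      (@Finset.measurableSet_biInter _ _ (ℱ t) _ _ fun s hs =>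
        @MeasurableSet.compl _ _ (ℱ t) (hE s t (Finset.mem_range.1 hs).le))
  have hdisj : ∀ s t, s < t → Disjoint (B s) (B t) := by
    intro s t hst
    rw [Set.disjoint_left]
    intro ω h1 h2
    have := Set.mem_iInter₂.1 h2.2 s (Finset.mem_range.2 hst)
    exact this h1.1
  have hpair : Pairwise (Function.onFun Disjoint B) := fun s t hst => by
    rcases lt_or_gt_of_ne hst with h | h
    · exact hdisj s t h
    · exact (hdisj t s h).symm
  have hsub : {ω | ∃ t, c ≤ f t ω} ⊆ ⋃ t, B t := by
    classical
    intro ω hω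
    refine Set.mem_iUnion.2 ⟨Nat.find hω, Nat.find_spec hω, ?_⟩
    exact Set.mem_iInter₂.2 fun s hs => Nat.find_min hω (Finset.mem_range.1 hs)
  have hiter : ∀ t n, t ≤ n → ∀ C, MeasurableSet[ℱ t] C →
      ∫⁻ ω in C, f n ω ∂P = ∫⁻ ω in C, f t ω ∂P := by
    intro t n htn C hC
    induction n, htn using Nat.le_induction with
    | base => rfl
    | succ n htn ih => rw [hstep n C (ℱ.mono htn C hC), ih]
  have hmass : ∀ n, ∫⁻ ω, f n ω ∂P ≤ 1 := by
    intro n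
    have := hiter 0 n (Nat.zero_le n) Set.univ (@MeasurableSet.univ _ (ℱ 0))
    simp only [Measure.restrict_univ] at this
    exact this.trans_le h0
  calc c * P {ω | ∃ t, c ≤ f t ω} ≤ c * P (⋃ t, B t) := by gcongr
    _ = ∑' t, c * P (B t) := by
      rw [measure_iUnion hpair fun t => ℱ.le t _ (hB t), ENNReal.tsum_mul_left]
    _ ≤ 1 := by
      refine ENNReal.tsum_le_of_sum_range_le fun n => ?_
      calc ∑ t ∈ Finset.range n, c * P (B t) ≤ ∑ t ∈ Finset.range n, ∫⁻ ω in B t, f n ω ∂P := by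
            refine Finset.sum_le_sum fun t ht => ?_
            rw [hiter t n (Finset.mem_range.1 ht).le _ (hB t), ← setLIntegral_const]
            exact setLIntegral_mono' (ℱ.le t _ (hB t)) fun ω hω => hω.1
        _ = ∫⁻ ω in ⋃ t ∈ Finset.range n, B t, f n ω ∂P :=
            (lintegral_biUnion_finset (hpair.set_pairwise _)
              (fun t _ => ℱ.le t _ (hB t)) _).symm
        _ ≤ ∫⁻ ω, f n ω ∂P := setLIntegral_le_lintegral _ _
        _ ≤ 1 := hmass n

/-- The likelihood ratio between the bandits `μ + θ` and `μ` after round `t`. -/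
noncomputable def expRatio {K : ℕ} (μ θ : Fin K → ℝ) (a : ℕ → Fin K) (y : ℕ → ℝ) (t : ℕ) : ℝ :=
  Real.exp (∑ s ∈ Finset.Icc 1 t, (θ (a s) * (y s - μ (a s)) - θ (a s) ^ 2 / 2))

section

variable {K : ℕ} {Ω : Type*}

lemma sum_pulled (a : ℕ → Fin K) (t : ℕ) (f : ℕ → Fin K → ℝ) :
    ∑ s ∈ Finset.Icc 1 t, f s (a s) =
      ∑ b, ∑ s ∈ Finset.Icc 1 t, if a s = b then f s b else 0 := by
  rw [Finset.sum_comm]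
  simp

lemma pulls_mul_empMean_sub (a : ℕ → Fin K) (y : ℕ → ℝ) (μ : Fin K → ℝ) (t : ℕ) (b : Fin K) :
    ∑ s ∈ Finset.Icc 1 t, (if a s = b then y s - μ b else 0) =
      pulls a t b * (empMean a y t b - μ b) := by
  have h1 : ∑ s ∈ Finset.Icc 1 t, (if a s = b then y s - μ b else 0) =
      ∑ s ∈ Finset.Icc 1 t, (if a s = b then y s else 0) - pulls a t b * μ b := by
    rw [pulls, Finset.card_filter, Nat.cast_sum, Finset.sum_mul, ← Finset.sum_sub_distrib]
    refine Finset.sum_congr rfl fun s _ => ?_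
    split_ifs <;> simp
  rw [h1, empMean]
  rcases Nat.eq_zero_or_pos (pulls a t b) with h0 | hpos
  · have : ∑ s ∈ Finset.Icc 1 t, (if a s = b then y s else 0) = 0 := by
      rw [pulls, Finset.card_eq_zero] at h0
      rw [← Finset.sum_filter, h0, Finset.sum_empty]
    rw [h0, this]
    simp
  · have : (pulls a t b : ℝ) ≠ 0 := by positivity
    field_simp

/-- The ratio depends on the past only through counts and empirical means. Each arm contributes `θ D
- θ² N / 2`, whose maximum over `θ` is its term `N d(μ̂, μ)` of the cost. -/
lemma expRatio_eq (μ θ : Fin K → ℝ) (a : ℕ → Fin K) (y : ℕ → ℝ) (t : ℕ) :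
    expRatio μ θ a y t = Real.exp (∑ b, (θ b * (pulls a t b * (empMean a y t b - μ b))
      - θ b ^ 2 * pulls a t b / 2)) := by
  rw [expRatio, sum_pulled a t fun s b => θ b * (y s - μ b) - θ b ^ 2 / 2]
  congr 1
  refine Finset.sum_congr rfl fun b _ => ?_
  rw [← pulls_mul_empMean_sub, pulls, Finset.card_filter, Nat.cast_sum, Finset.mul_sum,
    Finset.mul_sum, Finset.sum_div, ← Finset.sum_sub_distrib]
  refine Finset.sum_congr rfl fun s _ => ?_
  split_ifs <;> simp

lemma measurable_pulled {m : MeasurableSpace Ω} {A : Ω → Fin K} (hA : Measurable A) :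
    Measurable fun p : (Fin K → ℝ) × Ω => p.1 (A p.2) := by
  have : (fun p : (Fin K → ℝ) × Ω => p.1 (A p.2)) = fun p => ∑ b, if A p.2 = b then p.1 b else 0 := by
    ext p
    simp
  rw [this]
  refine Finset.measurable_sum _ fun b _ => Measurable.ite ?_ (by fun_prop) measurable_const
  exact measurableSet_eq_fun (hA.comp measurable_snd) measurable_const

lemma measurable_expRatio {m : MeasurableSpace Ω} {A : ℕ → Ω → Fin K} {Y : ℕ → Ω → ℝ} {t : ℕ}
    (hA : ∀ s ∈ Set.Icc 1 t, Measurable (A s)) (hY : ∀ s ∈ Set.Icc 1 t, Measurable (Y s))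
    (μ : Fin K → ℝ) :
    Measurable fun p : (Fin K → ℝ) × Ω =>
      ENNReal.ofReal (expRatio μ p.1 (fun s => A s p.2) (fun s => Y s p.2) t) := by
  refine (Real.measurable_exp.comp (Finset.measurable_sum _ fun s hs => ?_)).ennreal_ofReal
  rw [Finset.mem_Icc] at hs
  have h1 := measurable_pulled (hA s hs)
  have h2 : Measurable fun p : (Fin K → ℝ) × Ω => μ (A s p.2) :=
    (measurable_of_finite μ).comp ((hA s hs).comp measurable_snd)
  have h3 : Measurable fun p : (Fin K → ℝ) × Ω => Y s p.2 := (hY s hs).comp measurable_snd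
  exact (h1.mul (h3.sub h2)).sub ((h1.pow_const 2).div_const 2)

lemma measurable_expRatio_apply {m : MeasurableSpace Ω} {A : ℕ → Ω → Fin K} {Y : ℕ → Ω → ℝ}
    {t : ℕ} (hA : ∀ s ∈ Set.Icc 1 t, Measurable (A s)) (hY : ∀ s ∈ Set.Icc 1 t, Measurable (Y s))
    (μ θ : Fin K → ℝ) :
    Measurable fun ω => ENNReal.ofReal (expRatio μ θ (fun s => A s ω) (fun s => Y s ω) t) := by
  have h : Measurable fun ω : Ω => (θ, ω) := measurable_prodMk_left
  have h2 := (measurable_expRatio hA hY μ).comp h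
  simpa only [Function.comp_def] using h2

variable [mΩ : MeasurableSpace Ω] {A : ℕ → Ω → Fin K} {Y : ℕ → Ω → ℝ}
  (hA : ∀ t, Measurable (A t)) (hY : ∀ t, Measurable (Y t))

lemma measurable_history_pair {s t : ℕ} (hs : s ∈ Set.Icc 1 t) :
    Measurable[history hA hY t] fun ω => (A s ω, Y s ω) :=
  measurable_iff_comap_le.2 (le_iSup₂_of_le s hs le_rfl)

lemma measurable_history_arm {s t : ℕ} (hs : s ∈ Set.Icc 1 t) :
    Measurable[history hA hY t] (A s) :=
  measurable_fst.comp (measurable_history_pair hA hY hs)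

lemma measurable_history_reward {s t : ℕ} (hs : s ∈ Set.Icc 1 t) :
    Measurable[history hA hY t] (Y s) :=
  measurable_snd.comp (measurable_history_pair hA hY hs)

lemma lintegral_exp_gaussianReal (x : ℝ) :
    ∫⁻ z, ENNReal.ofReal (Real.exp (x * z - x ^ 2 / 2)) ∂(gaussianReal 0 1) = 1 := by
  have h1 : ∀ z : ℝ, Real.exp (x * z - x ^ 2 / 2) = Real.exp (x * z) * Real.exp (-(x ^ 2 / 2)) :=
    fun z => by rw [← Real.exp_add, sub_eq_add_neg]
  have hint : Integrable (fun z => Real.exp (x * z)) (gaussianReal 0 1) :=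
    integrable_exp_mul_gaussianReal x
  have h2 : ∫ z, Real.exp (x * z) ∂(gaussianReal 0 1) = Real.exp (x ^ 2 / 2) := by
    have := mgf_gaussianReal (p := gaussianReal 0 1) (X := id) (μ := 0) (v := 1)
      (by simp) x
    simpa [mgf] using this
  simp only [h1]
  rw [← ofReal_integral_eq_lintegral_ofReal (hint.mul_const _)
    (Eventually.of_forall fun z => by positivity), integral_mul_const, h2, ← Real.exp_add]
  simp

variable {hA hY}

/-- The likelihood ratios are martingales. -/
lemma setLIntegral_expRatio_succ {μ : Fin K → ℝ} {P : Measure Ω}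
    (hsampling : ∀ t, Measurable[history hA hY t] (A (t + 1)))
    (hP : IsGaussianBandit hA hY μ P) (θ : Fin K → ℝ) (t : ℕ) {B : Set Ω}
    (hB : MeasurableSet[history hA hY t] B) :
    ∫⁻ ω in B, ENNReal.ofReal (expRatio μ θ (fun s => A s ω) (fun s => Y s ω) (t + 1)) ∂P =
      ∫⁻ ω in B, ENNReal.ofReal (expRatio μ θ (fun s => A s ω) (fun s => Y s ω) t) ∂P := by
  classical
  set Z : Ω → ℝ≥0∞ := fun ω => ENNReal.ofReal (expRatio μ θ (fun s => A s ω) (fun s => Y s ω) t)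
  set X : Ω → ℝ := fun ω => Y (t + 1) ω - μ (A (t + 1) ω)
  set g : Fin K → ℝ → ℝ≥0∞ := fun b z => ENNReal.ofReal (Real.exp (θ b * z - θ b ^ 2 / 2))
  -- Once the next arm is fixed to `b`, the new factor is a function of the noise alone. It is
  -- independent of the history and has mean one.
  set C : Fin K → Set Ω := fun b => B ∩ {ω | A (t + 1) ω = b}
  have hBm := (history hA hY).le t _ hB
  have hC : ∀ b, MeasurableSet[history hA hY t] (C b) := fun b =>
    @MeasurableSet.inter _ (history hA hY t) _ _ hB (hsampling t (measurableSet_singleton b))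
  have hg : ∀ b, Measurable (g b) := fun b => by
    simp only [g]
    fun_prop
  have hZ : Measurable[history hA hY t] Z :=
    measurable_expRatio_apply (fun s hs => measurable_history_arm hA hY hs)
      (fun s hs => measurable_history_reward hA hY hs) μ θ
  have hCZ : ∀ b, Measurable[history hA hY t] ((C b).indicator Z) := fun b =>
    hZ.indicator (hC b)
  have hCZ' : ∀ b, Measurable ((C b).indicator Z) := fun b =>
    (hCZ b).mono ((history hA hY).le t) le_rfl
  have hX : Measurable X := (hY _).sub ((measurable_of_finite μ).comp (hA _))
  have hsum : ∀ f : Ω → ℝ≥0∞, ∀ ω, B.indicator f ω = ∑ b, (C b).indicator f ω := by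
    intro f ω
    by_cases hω : ω ∈ B
    · rw [Finset.sum_eq_single (A (t + 1) ω)]
      · simp [C, hω]
      · intro b _ hb
        exact Set.indicator_of_notMem (fun h => hb h.2.symm) _
      · simp
    · rw [Set.indicator_of_notMem hω, Finset.sum_eq_zero]
      exact fun b _ => Set.indicator_of_notMem (fun h => hω h.1) _
  have hprod : ∀ b ω, (C b).indicator (fun ω => ENNReal.ofReal
      (expRatio μ θ (fun s => A s ω) (fun s => Y s ω) (t + 1))) ω =
      (C b).indicator Z ω * g b (X ω) := by
    intro b ω
    by_cases hω : ω ∈ C b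
    · rw [Set.indicator_of_mem hω, Set.indicator_of_mem hω]
      simp only [Z, g, X]
      rw [expRatio, expRatio, ← ENNReal.ofReal_mul (Real.exp_pos _).le,
        Finset.sum_Icc_succ_top (by omega), Real.exp_add, hω.2]
    · rw [Set.indicator_of_notMem hω, Set.indicator_of_notMem hω, zero_mul]
  have hmul : ∀ b, ∫⁻ ω, (C b).indicator Z ω * g b (X ω) ∂P = ∫⁻ ω, (C b).indicator Z ω ∂P := by
    intro b
    rw [lintegral_mul_eq_lintegral_mul_lintegral_of_independent_measurableSpace
      (g := fun ω => g b (X ω)) ((history hA hY).le t) hX.comap_le (hP.noise_indep t).symm (hCZ b)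
      ((hg b).comp (comap_measurable X)), (hP.noise_law t).lintegral_comp (hg b).aemeasurable,
      lintegral_exp_gaussianReal, mul_one]
  rw [← lintegral_indicator hBm, ← lintegral_indicator hBm, lintegral_congr (hsum _),
    lintegral_congr (hsum Z)]
  simp only [hprod]
  rw [lintegral_finsetSum, lintegral_finsetSum]
  · exact Finset.sum_congr rfl fun b _ => hmul b
  · exact fun b _ => hCZ' b
  · exact fun b _ => (hCZ' b).mul ((hg b).comp hX)

lemma lintegral_expRatio {μ : Fin K → ℝ} {P : Measure Ω} [IsProbabilityMeasure P]
    (hsampling : ∀ t, Measurable[history hA hY t] (A (t + 1)))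
    (hP : IsGaussianBandit hA hY μ P) (θ : Fin K → ℝ) (t : ℕ) :
    ∫⁻ ω, ENNReal.ofReal (expRatio μ θ (fun s => A s ω) (fun s => Y s ω) t) ∂P = 1 := by
  induction t with
  | zero => simp [expRatio]
  | succ t ih =>
    have := setLIntegral_expRatio_succ hsampling hP θ t (@MeasurableSet.univ _ (history hA hY t))
    simp only [Measure.restrict_univ] at this
    rw [this, ih]

/-- A maximal inequality for mixtures of likelihood ratios. -/
lemma measure_exists_mixture_ge_le {μ : Fin K → ℝ} {P : Measure Ω} [IsProbabilityMeasure P]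
    (hsampling : ∀ t, Measurable[history hA hY t] (A (t + 1)))
    (hP : IsGaussianBandit hA hY μ P) (ρ : Measure (Fin K → ℝ)) [IsProbabilityMeasure ρ]
    (c : ℝ≥0∞) :
    c * P {ω | ∃ t, c ≤
      ∫⁻ θ, ENNReal.ofReal (expRatio μ θ (fun s => A s ω) (fun s => Y s ω) t) ∂ρ} ≤ 1 := by
  have hmeas : ∀ t, Measurable fun p : (Fin K → ℝ) × Ω =>
      ENNReal.ofReal (expRatio μ p.1 (fun s => A s p.2) (fun s => Y s p.2) t) := fun t =>
    measurable_expRatio (fun s _ => hA s) (fun s _ => hY s) μ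
  -- Tonelli reduces the martingale property of the mixture to that of each likelihood ratio.
  have hswap : ∀ t B, ∫⁻ ω in B, ∫⁻ θ, ENNReal.ofReal
      (expRatio μ θ (fun s => A s ω) (fun s => Y s ω) t) ∂ρ ∂P = ∫⁻ θ, ∫⁻ ω in B, ENNReal.ofReal
      (expRatio μ θ (fun s => A s ω) (fun s => Y s ω) t) ∂P ∂ρ := fun t B =>
    lintegral_lintegral_swap ((hmeas t).comp measurable_swap).aemeasurable
  refine measure_exists_ge_le (history hA hY) (fun t ω => ∫⁻ θ, ENNReal.ofReal
    (expRatio μ θ (fun s => A s ω) (fun s => Y s ω) t) ∂ρ) (fun t => ?_) (fun t B hB => ?_) ?_ c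
  · exact @Measurable.lintegral_prod_left' _ _ _ (history hA hY t) ρ _ _
      (@measurable_expRatio K Ω (history hA hY t) A Y t
      (fun s hs => measurable_history_arm hA hY hs)
      (fun s hs => measurable_history_reward hA hY hs) μ)
  · rw [hswap, hswap]
    exact lintegral_congr fun θ => setLIntegral_expRatio_succ hsampling hP θ t hB
  · simp [expRatio]

end

/-! ### The mixture density -/

/-- The density of the mixture, up to normalisation. -/
noncomputable def mixtureKernel (x : ℝ) : ℝ := 1 / (|x| * (abs (Real.log |x|) + 2) ^ (3 / 2 : ℝ))

lemma mixtureKernel_nonneg (x : ℝ) : 0 ≤ mixtureKernel x := by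
  unfold mixtureKernel; positivity

lemma integrableOn_shifted_rpow :
    IntegrableOn (fun u : ℝ => (u + 2) ^ (-(3 / 2) : ℝ)) (Set.Ioi 0) :=
  integrableOn_add_rpow_Ioi_of_lt (by norm_num) (by norm_num)

lemma integral_shifted_rpow :
    ∫ u in Set.Ioi (0 : ℝ), (u + 2) ^ (-(3 / 2) : ℝ) = √2 := by
  have h1 := integral_Ioi_of_hasDerivAt_of_tendsto' (a := 0)
    (f := fun u : ℝ => -2 * (u + 2) ^ (-(1 / 2) : ℝ)) (f' := fun u : ℝ => (u + 2) ^ (-(3 / 2) : ℝ))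
    (m := 0) (fun u hu => by
      have hu0 : (0 : ℝ) ≤ u := hu
      have := (((hasDerivAt_id u).add_const 2).rpow_const (p := -(1 / 2))
        (Or.inl (by simp only [id]; positivity))).const_mul (-2)
      convert! this using 1
      norm_num
      ring)
    integrableOn_shifted_rpow (by
      have := (tendsto_rpow_neg_atTop (y := 1 / 2) (by norm_num)).comp
        (tendsto_atTop_add_const_right _ (2 : ℝ) tendsto_id)
      simpa using this.const_mul (-2))
  rw [h1, Real.rpow_neg (by norm_num), zero_add, ← Real.sqrt_eq_rpow]
  have : √(2 : ℝ) * √2 = 2 := Real.mul_self_sqrt (by norm_num)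
  field_simp
  linarith

/-- The substitution `x = exp u` turns the kernel into an even power function of `u`, integrable
because `3 / 2 > 1`. -/
lemma even_rpow_eq (u : ℝ) :
    |Real.exp u| • mixtureKernel (Real.exp u) = (|u| + 2) ^ (-(3 / 2) : ℝ) := by
  have := Real.exp_pos u
  rw [mixtureKernel, abs_of_pos this, Real.log_exp, Real.rpow_neg (by positivity), smul_eq_mul]
  field_simp

lemma image_exp_univ : Real.exp '' Set.univ = Set.Ioi 0 := by
  rw [Set.image_univ, Real.range_exp]

lemma integrable_even_rpow : Integrable fun u : ℝ => (|u| + 2) ^ (-(3 / 2) : ℝ) := by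
  refine (integrable_one_add_norm (E := ℝ) (r := 3 / 2) (by norm_num)).mono'
    (by simp only [← Real.norm_eq_abs]; exact Measurable.aestronglyMeasurable (by fun_prop))
    (Eventually.of_forall fun u => ?_)
  rw [Real.norm_of_nonneg (by positivity), Real.norm_eq_abs]
  exact Real.rpow_le_rpow_of_nonpos (by positivity) (by linarith) (by norm_num)

lemma integrableOn_mixtureKernel_Ioi : IntegrableOn mixtureKernel (Set.Ioi 0) := by
  rw [← image_exp_univ, integrableOn_image_iff_integrableOn_abs_deriv_smul MeasurableSet.univ
    (fun x _ => (Real.hasDerivAt_exp x).hasDerivWithinAt) Real.exp_injective.injOn]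
  simp only [even_rpow_eq]
  exact integrable_even_rpow.integrableOn

lemma mixtureKernel_neg (x : ℝ) : mixtureKernel (-x) = mixtureKernel x := by
  simp [mixtureKernel]

lemma integrable_mixtureKernel : Integrable mixtureKernel := by
  rw [← integrableOn_univ, ← Set.Iic_union_Ioi (a := (0 : ℝ)), integrableOn_union]
  refine ⟨?_, integrableOn_mixtureKernel_Ioi⟩
  rw [integrableOn_Iic_iff_integrableOn_Iio]
  have h : IntegrableOn mixtureKernel (Set.Ioi (-0)) := by
    rw [neg_zero]; exact integrableOn_mixtureKernel_Ioi
  simpa only [mixtureKernel_neg] using h.comp_neg_Iio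

/-- Four equal pieces of mass `√2`, according to the signs of `x` and of `log |x|`. -/
lemma integral_mixtureKernel : ∫ x, mixtureKernel x = 4 * √2 := by
  have h1 : ∀ x, mixtureKernel x = mixtureKernel |x| := fun x => by simp [mixtureKernel]
  rw [integral_congr_ae (Eventually.of_forall h1), integral_comp_abs, ← image_exp_univ,
    integral_image_eq_integral_abs_deriv_smul MeasurableSet.univ
    (fun x _ => (Real.hasDerivAt_exp x).hasDerivWithinAt) Real.exp_injective.injOn]
  simp only [even_rpow_eq, Measure.restrict_univ]
  rw [integral_comp_abs (f := fun u => (u + 2) ^ (-(3 / 2) : ℝ)), integral_shifted_rpow]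
  ring

lemma mixtureNorm_eq : mixtureNorm = (4 * √2)⁻¹ := by
  rw [← integral_mixtureKernel]; rfl

lemma mixtureNorm_pos : 0 < mixtureNorm := by rw [mixtureNorm_eq]; positivity

lemma log_mixtureNorm : Real.log mixtureNorm = -(5 / 2 * Real.log 2) := by
  rw [mixtureNorm_eq, Real.log_inv, Real.log_mul (by norm_num) (by positivity),
    Real.log_sqrt (by norm_num), show (4 : ℝ) = 2 ^ 2 by norm_num, Real.log_pow]
  push_cast
  ring

lemma thresholdConst_eq : thresholdConst = 30 * Real.log 2 + 5 := by
  rw [thresholdConst, Real.log_mul (by norm_num) (Real.exp_ne_zero _), Real.log_exp,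
    log_mixtureNorm]
  ring

/-- The mixture distribution on the real line. -/
noncomputable def mixture : Measure ℝ :=
  volume.withDensity fun x => ENNReal.ofReal (mixtureNorm * mixtureKernel x)

instance : IsProbabilityMeasure mixture := by
  refine ⟨?_⟩
  rw [mixture, withDensity_apply _ MeasurableSet.univ, Measure.restrict_univ,
    ← ofReal_integral_eq_lintegral_ofReal (integrable_mixtureKernel.const_mul _)
      (Eventually.of_forall fun x => mul_nonneg mixtureNorm_pos.le (mixtureKernel_nonneg x)),
    integral_const_mul, integral_mixtureKernel, mixtureNorm_eq, inv_mul_cancel₀ (by positivity)]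
  simp

/-- There is a set of large mixture probability on which the exponent `θ D - θ² N / 2` is close to
its maximum `D² / (2 N)`. -/
lemma exists_set_mixture_ge {N : ℝ} (hN : 1 ≤ N) (D : ℝ) :
    ∃ J : Set ℝ, MeasurableSet J ∧
      (∀ θ ∈ J, D ^ 2 / (2 * N) - 1 / 2 ≤ θ * D - θ ^ 2 * N / 2) ∧
      ENNReal.ofReal (Real.exp (-(Real.log (2 + 4 * (D ^ 2 / (2 * N)))
        + 2 * Real.log (Real.log N + 3) + 1 / 2 + 7 / 2 * Real.log 2))) ≤ mixture J := by
  have hN0 : 0 < N := by linarith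
  set q := √N
  have hq : q ^ 2 = N := Real.sq_sqrt hN0.le
  have hq1 : 1 ≤ q := Real.one_le_sqrt.2 hN
  have hq0 : 0 < q := by linarith
  set p := |D| / q
  have hp : 0 ≤ p := by positivity
  have hD : |D| = p * q := by simp only [p]; field_simp
  have hD2 : D ^ 2 = p ^ 2 * N := by rw [← sq_abs, hD, ← hq]; ring
  set l := (p + 1 / 2) / q
  set u := (p + 1) / q
  have hl : 0 < l := by positivity
  have hu : 0 < u := by positivity
  have hul : u - l = 1 / (2 * q) := by simp only [u, l]; field_simp; ring
  obtain ⟨J, hJm, hJvol, hJ⟩ : ∃ J : Set ℝ, MeasurableSet J ∧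
      volume J = ENNReal.ofReal (u - l) ∧ ∀ θ ∈ J, l ≤ |θ| ∧ |θ| ≤ u ∧ θ * D = |θ| * |D| := by
    rcases le_total 0 D with h | h
    · refine ⟨Set.Icc l u, measurableSet_Icc, Real.volume_Icc, fun θ hθ => ?_⟩
      have : 0 ≤ θ := hl.le.trans hθ.1
      rw [abs_of_nonneg this, abs_of_nonneg h]
      exact ⟨hθ.1, hθ.2, rfl⟩
    · refine ⟨Set.Icc (-u) (-l), measurableSet_Icc, by rw [Real.volume_Icc]; congr 1; ring,
        fun θ hθ => ?_⟩
      have : θ ≤ 0 := hθ.2.trans (by linarith)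
      rw [abs_of_nonpos this, abs_of_nonpos h]
      exact ⟨by linarith [hθ.2], by linarith [hθ.1], by ring⟩
  refine ⟨J, hJm, fun θ hθ => ?_, ?_⟩
  · obtain ⟨h1, h2, h3⟩ := hJ θ hθ
    rw [h3, ← sq_abs θ, hD, hD2, ← hq]
    set e := |θ| * q - p
    have he : |θ| = (p + e) / q := by simp only [e]; field_simp; ring
    have he1 : 1 / 2 ≤ e := by
      rw [div_le_iff₀ hq0] at h1
      simp only [e]; linarith
    have he2 : e ≤ 1 := by
      rw [le_div_iff₀ hq0] at h2
      simp only [e]; linarith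
    have h4 : p ^ 2 * q ^ 2 / (2 * q ^ 2) = p ^ 2 / 2 := by field_simp
    have h5 : |θ| * (p * q) - |θ| ^ 2 * q ^ 2 / 2 = (p + e) * p - (p + e) ^ 2 / 2 := by
      rw [he]; field_simp
    rw [h4, h5]
    nlinarith
  · have hlogN : 0 ≤ Real.log N := Real.log_nonneg hN
    have hlogq : Real.log q = Real.log N / 2 := Real.log_sqrt hN0.le
    set r := Real.log (1 + p)
    have hr : 0 ≤ r := Real.log_nonneg (by linarith)
    have hlog2 : Real.log 2 < 0.6931471808 := Real.log_two_lt_d9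
    have hlog2' : 0 < Real.log 2 := Real.log_pos (by norm_num)
    set m := Real.log 2 + Real.log N / 2 + r
    have hm : 0 ≤ m := by positivity
    have hkernel : ∀ θ ∈ J, mixtureNorm * (1 / (u * (m + 2) ^ (3 / 2 : ℝ))) ≤
        mixtureNorm * mixtureKernel θ := by
      intro θ hθ
      obtain ⟨h1, h2, -⟩ := hJ θ hθ
      have hθ0 : 0 < |θ| := hl.trans_le h1
      have h3 : abs (Real.log |θ|) ≤ m := by
        rw [abs_le]
        constructor
        · have h4 : 1 / (2 * q) ≤ |θ| := by
            refine le_trans ?_ h1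
            simp only [l]
            rw [div_le_div_iff₀ (by positivity) hq0]
            nlinarith
          have h5 := Real.log_le_log (by positivity) h4
          rw [one_div, Real.log_inv, Real.log_mul (by norm_num) hq0.ne', hlogq] at h5
          simp only [m]
          linarith
        · have h5 := Real.log_le_log hθ0 h2
          simp only [u] at h5
          rw [Real.log_div (by positivity) hq0.ne', hlogq, add_comm p] at h5
          simp only [m]
          linarith
      refine mul_le_mul_of_nonneg_left ?_ mixtureNorm_pos.le
      unfold mixtureKernel
      gcongr
    have hmeas : ENNReal.ofReal (mixtureNorm * (1 / (u * (m + 2) ^ (3 / 2 : ℝ))))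
        * ENNReal.ofReal (u - l) ≤ mixture J := by
      rw [mixture, withDensity_apply _ hJm, ← hJvol, ← setLIntegral_const]
      exact setLIntegral_mono' hJm fun θ hθ => ENNReal.ofReal_le_ofReal (hkernel θ hθ)
    have hnp := mixtureNorm_pos
    refine le_trans ?_ hmeas
    rw [← ENNReal.ofReal_mul (by positivity)]
    refine ENNReal.ofReal_le_ofReal ?_
    rw [hul]
    -- The length of `J` times `1 / u` is `1 / (2 (1 + p))`: the factors `√N` cancel, so `N`
    -- survives only through `log log N`.
    have hval : mixtureNorm * (1 / (u * (m + 2) ^ (3 / 2 : ℝ))) * (1 / (2 * q)) =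
        Real.exp (Real.log mixtureNorm - Real.log 2 - r - 3 / 2 * Real.log (m + 2)) := by
      rw [Real.exp_sub, Real.exp_sub, Real.exp_sub, Real.exp_log hnp, Real.exp_log (by norm_num),
        Real.exp_log (by positivity), mul_comm (3 / 2 : ℝ), ← Real.rpow_def_of_pos (by positivity)]
      simp only [u]
      field_simp
      ring
    rw [hval]
    refine Real.exp_le_exp.2 ?_
    rw [log_mixtureNorm]
    have h1 : 0 ≤ Real.log (m + 2) := Real.log_nonneg (by linarith)
    have h2 : Real.log (m + 2) ≤ Real.log (Real.log N + 3) + Real.log (1 + r) := by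
      rw [← Real.log_mul (by positivity) (by positivity)]
      refine Real.log_le_log (by positivity) ?_
      simp only [m]
      nlinarith [mul_nonneg hlogN hr]
    have h3 : Real.log (1 + r) ≤ Real.log 2 + (1 + r) / 2 - 1 := by
      have h4 := Real.log_le_sub_one_of_pos (x := (1 + r) / 2) (by positivity)
      rw [Real.log_div (by positivity) (by norm_num)] at h4
      linarith
    -- This is `(1 + p)² ≤ 2 + 2 p²`.
    have h5 : 2 * r ≤ Real.log (2 + 4 * (D ^ 2 / (2 * N))) := by
      have h6 : (2 : ℝ) * r = Real.log ((1 + p) ^ 2) := by rw [Real.log_pow]; norm_num [r]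
      rw [h6]
      refine Real.log_le_log (by positivity) ?_
      rw [hD2]
      have : 4 * (p ^ 2 * N / (2 * N)) = 2 * p ^ 2 := by field_simp; ring
      nlinarith [sq_nonneg (p - 1)]
    linarith

/-- The threshold dominates the losses of the mixture. -/
lemma le_sum_sub_loss {K : ℕ} [NeZero K] {x n : Fin K → ℝ} {ℓ : ℝ} (hx : ∀ b, 0 ≤ x b)
    (hn : ∀ b, 0 ≤ Real.log (n b)) (hℓ : 0 < ℓ)
    (h : ℓ + K * Real.log (4 * ℓ + 1) + 6 * ∑ b, Real.log (n b) + K * thresholdConst ≤ ∑ b, x b) :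
    ℓ ≤ ∑ b, (x b - 1 / 2 - (Real.log (2 + 4 * x b) + 2 * Real.log (n b) + 1 / 2
      + 7 / 2 * Real.log 2)) := by
  have hK : (1 : ℝ) ≤ K := by exact_mod_cast Nat.one_le_iff_ne_zero.2 (NeZero.ne K)
  set Λ := Real.log (4 * ℓ + 1)
  have hΛ : 0 ≤ Λ := Real.log_nonneg (by linarith)
  have hΛ' : Λ ≤ 4 * ℓ := by
    have := Real.log_le_sub_one_of_pos (x := 4 * ℓ + 1) (by positivity)
    linarith
  -- `κ` is the slope in `x` of the tangent to `log (2 + 4 x)` at the point where its argument is `8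
  -- (4 ℓ + 1)`. Then `κ ℓ ≤ 1/8` and `κ Λ ≤ 1/2`, so shrinking the cost by `1 - κ` loses only
  -- constants from `ℓ + K Λ`.
  set κ := 1 / (2 * (4 * ℓ + 1))
  have hκ : 0 ≤ κ := by positivity
  have hκ2 : κ ≤ 1 / 2 := one_div_le_one_div_of_le (by norm_num) (by linarith)
  have hκ3 : κ * (2 * (4 * ℓ + 1)) = 1 := by simp only [κ]; field_simp
  have hlog2 : 0.6931471803 < Real.log 2 := Real.log_two_gt_d9
  have h1 : ∀ b, Real.log (2 + 4 * x b) ≤ 3 * Real.log 2 + Λ + κ * x b - 3 / 4 := by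
    intro b
    have h2 := Real.log_le_sub_one_of_pos (x := (2 + 4 * x b) / (8 * (4 * ℓ + 1)))
      (div_pos (by linarith [hx b]) (by positivity))
    have h3 : Real.log (8 * (4 * ℓ + 1)) = 3 * Real.log 2 + Λ := by
      rw [Real.log_mul (by norm_num) (by positivity), show (8 : ℝ) = 2 ^ 3 by norm_num,
        Real.log_pow]
      norm_num [Λ]
    rw [Real.log_div (by linarith [hx b]) (by positivity), h3] at h2
    have h4 : (2 + 4 * x b) / (8 * (4 * ℓ + 1)) = κ / 2 + κ * x b := by
      simp only [κ]; field_simp; ring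
    rw [h4] at h2
    linarith
  set s := ∑ b, Real.log (n b)
  have hs : 0 ≤ s := Finset.sum_nonneg fun b _ => hn b
  set X := ∑ b, x b
  have h2 : ∑ b, (x b - 1 / 2 - (3 * Real.log 2 + Λ + κ * x b - 3 / 4 + 2 * Real.log (n b) + 1 / 2
      + 7 / 2 * Real.log 2)) ≤ ∑ b, (x b - 1 / 2 - (Real.log (2 + 4 * x b)
      + 2 * Real.log (n b) + 1 / 2 + 7 / 2 * Real.log 2)) :=
    Finset.sum_le_sum fun b _ => by linarith [h1 b]
  have h3 : ∑ b, (x b - 1 / 2 - (3 * Real.log 2 + Λ + κ * x b - 3 / 4 + 2 * Real.log (n b) + 1 / 2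
      + 7 / 2 * Real.log 2)) =
      (1 - κ) * X - 2 * s - K * (1 / 4 + 13 / 2 * Real.log 2 + Λ) := by
    have : ∀ b, x b - 1 / 2 - (3 * Real.log 2 + Λ + κ * x b - 3 / 4 + 2 * Real.log (n b) + 1 / 2
      + 7 / 2 * Real.log 2) = (1 - κ) * x b - 2 * Real.log (n b)
        - (1 / 4 + 13 / 2 * Real.log 2 + Λ) := fun b => by ring
    simp only [this, Finset.sum_sub_distrib, ← Finset.mul_sum, Finset.sum_const, Finset.card_univ,
      Fintype.card_fin, nsmul_eq_mul, X, s]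
  rw [thresholdConst_eq] at h
  have h4 := mul_le_mul_of_nonneg_left h (by linarith : 0 ≤ 1 - κ)
  have h5 : κ * ℓ ≤ 1 / 8 := by nlinarith
  have h6 : κ * Λ ≤ 1 / 2 := by nlinarith
  have h7 : κ * (6 * s + K * (30 * Real.log 2 + 5)) ≤
      1 / 2 * (6 * s + K * (30 * Real.log 2 + 5)) :=
    mul_le_mul_of_nonneg_right hκ2 (by positivity)
  have h8 : (K : ℝ) * (κ * Λ) ≤ K * (1 / 2) := mul_le_mul_of_nonneg_left h6 (by linarith)
  have h9 : (K : ℝ) * 0.6931471803 ≤ K * Real.log 2 :=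
    mul_le_mul_of_nonneg_left hlog2.le (by linarith)
  have h10 : (1 - κ) * (ℓ + K * Λ + 6 * s + K * (30 * Real.log 2 + 5)) =
    ℓ + K * Λ + 6 * s + 30 * (K * Real.log 2) + 5 * K - κ * ℓ - K * (κ * Λ)
      - κ * (6 * s + K * (30 * Real.log 2 + 5)) := by ring
  linarith

/-! ### Deviations of the empirical means -/

section

variable {K : ℕ} {Ω : Type*} [mΩ : MeasurableSpace Ω] {A : ℕ → Ω → Fin K} {Y : ℕ → Ω → ℝ}
  {hA : ∀ t, Measurable (A t)} {hY : ∀ t, Measurable (Y t)}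

/-- A Laplace bound: the integral is restricted to the box of the sets `J b`, where the exponent is
within `1/2` per arm of its maximum, and the prior mass of the box is a product. -/
lemma le_lintegral_expRatio_mixture [NeZero K] {μ : Fin K → ℝ} {a : ℕ → Fin K} {y : ℕ → ℝ} {t : ℕ}
    (hpulls : ∀ b, 1 ≤ pulls a t b) {δ : ℝ} (hδ : 0 < δ) (hδ1 : δ < 1)
    (h : threshold (pulls a t) δ ≤ cost (fun b => (pulls a t b : ℝ)) (empMean a y t) μ) :
    ENNReal.ofReal (1 / δ) ≤
      ∫⁻ θ, ENNReal.ofReal (expRatio μ θ a y t) ∂(Measure.pi fun _ : Fin K => mixture) := by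
  have hN : ∀ b, (1 : ℝ) ≤ pulls a t b := fun b => by exact_mod_cast hpulls b
  set D : Fin K → ℝ := fun b => pulls a t b * (empMean a y t b - μ b) with hD
  choose J hJm hJ hJρ using fun b => exists_set_mixture_ge (hN b) (D b)
  set x : Fin K → ℝ := fun b => D b ^ 2 / (2 * pulls a t b) with hx
  have hxcost : cost (fun b => (pulls a t b : ℝ)) (empMean a y t) μ = ∑ b, x b := by
    refine Finset.sum_congr rfl fun b _ => ?_
    have := hN b
    simp only [hx, hD, gaussDiv]
    field_simp
  have hℓ : 0 < Real.log (1 / δ) := Real.log_pos (by rw [lt_div_iff₀ hδ]; linarith)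
  have hlogN : ∀ b, 0 ≤ Real.log (pulls a t b : ℝ) := fun b => Real.log_nonneg (hN b)
  have hsum := le_sum_sub_loss (x := x) (n := fun b => Real.log (pulls a t b : ℝ) + 3)
    (fun b => by have := hN b; positivity)
    (fun b => Real.log_nonneg (by linarith [hlogN b])) hℓ (by rw [← hxcost]; exact h)
  have hbox : ∀ θ ∈ Set.univ.pi J, Real.exp (∑ b, (x b - 1 / 2)) ≤ expRatio μ θ a y t := by
    intro θ hθ
    rw [expRatio_eq]
    exact Real.exp_le_exp.2 (Finset.sum_le_sum fun b _ => hJ b (θ b) (hθ b (Set.mem_univ b)))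
  calc ENNReal.ofReal (1 / δ)
      ≤ ENNReal.ofReal (Real.exp (∑ b, (x b - 1 / 2)) * ∏ b, Real.exp
          (-(Real.log (2 + 4 * x b) + 2 * Real.log (Real.log (pulls a t b : ℝ) + 3) + 1 / 2
            + 7 / 2 * Real.log 2))) := by
        refine ENNReal.ofReal_le_ofReal ?_
        rw [← Real.exp_sum, ← Real.exp_add, ← Finset.sum_add_distrib,
          ← Real.exp_log (by positivity : 0 < 1 / δ)]
        exact Real.exp_le_exp.2 (hsum.trans_eq (Finset.sum_congr rfl fun b _ => by ring))
    _ = ENNReal.ofReal (Real.exp (∑ b, (x b - 1 / 2))) * ∏ b, ENNReal.ofReal (Real.exp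
          (-(Real.log (2 + 4 * x b) + 2 * Real.log (Real.log (pulls a t b : ℝ) + 3) + 1 / 2
            + 7 / 2 * Real.log 2))) := by
        rw [ENNReal.ofReal_mul (Real.exp_pos _).le,
          ENNReal.ofReal_prod_of_nonneg fun b _ => (Real.exp_pos _).le]
    _ ≤ ENNReal.ofReal (Real.exp (∑ b, (x b - 1 / 2))) *
          (Measure.pi fun _ : Fin K => mixture) (Set.univ.pi J) := by
        rw [Measure.pi_pi]
        gcongr with b
        exact hJρ b
    _ ≤ ∫⁻ θ in Set.univ.pi J, ENNReal.ofReal (expRatio μ θ a y t)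
          ∂(Measure.pi fun _ : Fin K => mixture) := by
        rw [← setLIntegral_const]
        exact setLIntegral_mono' (MeasurableSet.univ_pi hJm)
          fun θ hθ => ENNReal.ofReal_le_ofReal (hbox θ hθ)
    _ ≤ _ := setLIntegral_le_lintegral _ _

/-- Time-uniform deviation inequality. -/
lemma measure_exists_threshold_le [NeZero K] {μ : Fin K → ℝ} {P : Measure Ω}
    [IsProbabilityMeasure P] (hsampling : ∀ t, Measurable[history hA hY t] (A (t + 1)))
    (hP : IsGaussianBandit hA hY μ P) {δ : ℝ} (hδ : 0 < δ) (hδ1 : δ < 1) :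
    P {ω | ∃ t, (∀ b, 1 ≤ pulls (fun s => A s ω) t b) ∧
      threshold (pulls (fun s => A s ω) t) δ ≤ cost (fun b => (pulls (fun s => A s ω) t b : ℝ))
        (empMean (fun s => A s ω) (fun s => Y s ω) t) μ} ≤ ENNReal.ofReal δ := by
  have h1 := measure_exists_mixture_ge_le hsampling hP (Measure.pi fun _ : Fin K => mixture)
    (ENNReal.ofReal (1 / δ))
  have h2 : ENNReal.ofReal δ * ENNReal.ofReal (1 / δ) = 1 := by
    rw [← ENNReal.ofReal_mul hδ.le, mul_one_div_cancel hδ.ne', ENNReal.ofReal_one]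
  have h3 := mul_le_mul_right h1 (ENNReal.ofReal δ)
  rw [← mul_assoc, h2, one_mul, mul_one] at h3
  refine (measure_mono fun ω hω => ?_).trans h3
  obtain ⟨t, ht1, ht2⟩ := hω
  exact ⟨t, le_lintegral_expRatio_mixture ht1 hδ hδ1 ht2⟩

/-- Deviation inequality at a fixed time. -/
lemma measure_empMean_sub_ge_le {μ : Fin K → ℝ} {P : Measure Ω}
    [IsProbabilityMeasure P] (hsampling : ∀ t, Measurable[history hA hY t] (A (t + 1)))
    (hP : IsGaussianBandit hA hY μ P) {ξ n : ℝ} (hξ : 0 < ξ) (t : ℕ) (b : Fin K) :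
    P {ω | n ≤ pulls (fun s => A s ω) t b ∧
      ξ ≤ |empMean (fun s => A s ω) (fun s => Y s ω) t b - μ b|} ≤
      2 * ENNReal.ofReal (Real.exp (-(ξ ^ 2 * n / 2))) := by
  classical
  -- Markov's inequality for the ratio tilted by `σ = ±ξ` in coordinate `b`. On the event the
  -- exponent is at least `ξ² N - ξ² N / 2`, so a deterministic tilt handles the random count `N ≥
  -- n`.
  have key : ∀ σ : ℝ, σ ^ 2 = ξ ^ 2 → P {ω | n ≤ pulls (fun s => A s ω) t b ∧
      ξ ^ 2 ≤ σ * (empMean (fun s => A s ω) (fun s => Y s ω) t b - μ b)} ≤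
      ENNReal.ofReal (Real.exp (-(ξ ^ 2 * n / 2))) := by
    intro σ hσ
    set θ : Fin K → ℝ := Pi.single b σ
    have h1 := mul_meas_ge_le_lintegral (μ := P)
      (measurable_expRatio_apply (t := t) (fun s _ => hA s) (fun s _ => hY s) μ θ)
      (ENNReal.ofReal (Real.exp (ξ ^ 2 * n / 2)))
    rw [lintegral_expRatio hsampling hP] at h1
    have h2 : ENNReal.ofReal (Real.exp (-(ξ ^ 2 * n / 2))) *
        ENNReal.ofReal (Real.exp (ξ ^ 2 * n / 2)) = 1 := by
      rw [← ENNReal.ofReal_mul (Real.exp_pos _).le, ← Real.exp_add]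
      simp
    have h3 := mul_le_mul_right h1 (ENNReal.ofReal (Real.exp (-(ξ ^ 2 * n / 2))))
    rw [← mul_assoc, h2, one_mul, mul_one] at h3
    refine (measure_mono fun ω hω => ?_).trans h3
    obtain ⟨hω1, hω2⟩ := hω
    refine ENNReal.ofReal_le_ofReal ?_
    rw [expRatio_eq]
    refine Real.exp_le_exp.2 ?_
    rw [Finset.sum_eq_single b (fun c _ hc => by simp [θ, hc]) (by simp)]
    simp only [θ, Pi.single_eq_same, hσ]
    have hN : (0 : ℝ) ≤ pulls (fun s => A s ω) t b := Nat.cast_nonneg _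
    nlinarith [mul_le_mul_of_nonneg_left hω2 hN, mul_le_mul_of_nonneg_left hω1 (sq_nonneg ξ)]
  calc _ ≤ P ({ω | n ≤ pulls (fun s => A s ω) t b ∧
        ξ ^ 2 ≤ ξ * (empMean (fun s => A s ω) (fun s => Y s ω) t b - μ b)} ∪
        {ω | n ≤ pulls (fun s => A s ω) t b ∧
        ξ ^ 2 ≤ -ξ * (empMean (fun s => A s ω) (fun s => Y s ω) t b - μ b)}) := by
        refine measure_mono fun ω hω => ?_
        obtain ⟨hω1, hω2⟩ := hω
        rcases le_abs.1 hω2 with h | h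
        · exact Or.inl ⟨hω1, by nlinarith⟩
        · exact Or.inr ⟨hω1, by nlinarith⟩
    _ ≤ _ := measure_union_le _ _
    _ ≤ _ := add_le_add (key ξ rfl) (key (-ξ) (neg_sq ξ))
    _ = _ := (two_mul _).symm

lemma summable_sq_add_one_mul_exp_neg_sqrt {c : ℝ} (hc : 0 < c) :
    Summable fun t : ℕ => ((t : ℝ) ^ 2 + 1) * Real.exp (-(c * √(t : ℝ))) := by
  have h1 : Summable fun t : ℕ => (2 * (Nat.factorial 8 : ℝ) / c ^ 8) * (1 / (t : ℝ) ^ 2) :=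
    (Real.summable_one_div_nat_pow.2 (by norm_num)).mul_left _
  refine Summable.of_norm_bounded_eventually_nat h1 ?_
  filter_upwards [eventually_ge_atTop 1] with t ht
  have ht1 : (1 : ℝ) ≤ t := by exact_mod_cast ht
  have hsq : √(t : ℝ) ^ 2 = t := Real.sq_sqrt (by linarith)
  rw [Real.norm_of_nonneg (by positivity)]
  -- The eighth term of the exponential series is of order `t⁴`, which leaves `1 / t²` after
  -- division.
  have h2 : c ^ 8 * (t : ℝ) ^ 4 / (Nat.factorial 8 : ℝ) ≤ Real.exp (c * √(t : ℝ)) := by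
    refine le_trans (le_of_eq ?_) (Real.pow_div_factorial_le_exp _ (by positivity) 8)
    rw [mul_pow, show √(t : ℝ) ^ 8 = (√(t : ℝ) ^ 2) ^ 4 by ring, hsq]
  have h3 : (0 : ℝ) < Nat.factorial 8 := by exact_mod_cast Nat.factorial_pos 8
  rw [Real.exp_neg]
  calc ((t : ℝ) ^ 2 + 1) * (Real.exp (c * √(t : ℝ)))⁻¹
      ≤ (2 * (t : ℝ) ^ 2) * (c ^ 8 * (t : ℝ) ^ 4 / (Nat.factorial 8 : ℝ))⁻¹ := by
        gcongr
        nlinarith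
    _ = _ := by field_simp

/-- The expectation of a time `τ` that is at most `T` as soon as no bad event happens in
rounds `√T, …, T`. -/
lemma lintegral_le_add_tsum_bad {P : Measure Ω} [IsProbabilityMeasure P] (τ : Ω → ℕ∞)
    (B : ℕ → Set Ω) (T₁ : ℕ)
    (h : ∀ ω, ∀ T ≥ T₁, (∀ t ≤ T, T ≤ t ^ 2 → ω ∉ B t) → τ ω ≤ T) :
    ∫⁻ ω, (τ ω : ℝ≥0∞) ∂P ≤ T₁ + ∑' t : ℕ, ((t : ℝ≥0∞) ^ 2 + 1) * P (B t) := by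
  -- If `T < τ` with `T ≥ T₁`, some bad event occurs at a `t` with `T ≤ t²`, and its weight `t² + 1`
  -- already exceeds `T`. Measurable hulls are used since the `B t` are arbitrary sets.
  set R : Ω → ℝ≥0∞ := fun ω => ∑' t : ℕ,
    (toMeasurable P (B t)).indicator (fun _ => (t : ℝ≥0∞) ^ 2 + 1) ω
  have hR : ∀ ω, ∀ T ≥ T₁, (T : ℕ∞) < τ ω → (T : ℝ≥0∞) + 1 ≤ R ω := by
    intro ω T hT hlt
    by_contra hcon
    refine absurd (h ω T hT fun t _ ht hB => hcon ?_) (not_le.2 hlt)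
    calc (T : ℝ≥0∞) + 1 ≤ (t : ℝ≥0∞) ^ 2 + 1 := by gcongr; exact_mod_cast ht
      _ = (toMeasurable P (B t)).indicator (fun _ => (t : ℝ≥0∞) ^ 2 + 1) ω :=
        by rw [Set.indicator_of_mem (subset_toMeasurable P _ hB)]
      _ ≤ R ω := ENNReal.le_tsum t
  have hpt : ∀ ω, (τ ω : ℝ≥0∞) ≤ T₁ + R ω := by
    intro ω
    rcases le_or_gt (τ ω) T₁ with hle | hlt
    · refine le_trans ?_ le_self_add
      exact_mod_cast ENat.toENNReal_le.2 hle
    · refine le_trans ?_ le_add_self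
      induction hτ : τ ω using ENat.recTopCoe with
      | top =>
        refine le_of_eq ?_
        rw [ENat.toENNReal_top, eq_comm]
        refine ENNReal.eq_top_of_forall_nnreal_le fun r => ?_
        obtain ⟨n, hn⟩ := exists_nat_ge r
        have := hR ω (max n T₁) (le_max_right _ _) (by rw [hτ]; exact ENat.natCast_lt_top _)
        refine le_trans ?_ (le_self_add.trans this)
        calc (r : ℝ≥0∞) ≤ n := by exact_mod_cast hn
          _ ≤ _ := by exact_mod_cast le_max_left _ _
      | coe n =>
        rw [hτ] at hlt
        have hlt' : T₁ < n := by exact_mod_cast hlt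
        obtain ⟨m, rfl⟩ : ∃ m, n = m + 1 := ⟨n - 1, by omega⟩
        have := hR ω m (by omega) (by rw [hτ]; exact_mod_cast Nat.lt_succ_self m)
        simpa using this
  calc ∫⁻ ω, (τ ω : ℝ≥0∞) ∂P ≤ ∫⁻ ω, (T₁ + R ω) ∂P := lintegral_mono hpt
    _ = T₁ + ∫⁻ ω, R ω ∂P := by
      rw [lintegral_add_left measurable_const]
      simp
    _ = _ := by
      rw [lintegral_tsum fun t =>
        (measurable_const.indicator (measurableSet_toMeasurable _ _)).aemeasurable]
      congr 1
      refine tsum_congr fun t => ?_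
      rw [lintegral_indicator_const (measurableSet_toMeasurable _ _), measure_toMeasurable]

end

/-- For `t ≥ 2 K` forced exploration gives `√t / (8 K) - K`; the condition `256 K⁴ ≤ t` says exactly
that half of the first term covers `K`. -/
lemma IsRun.sqrt_le_pulls {K : ℕ} [NeZero K] {grad : (Fin K → ℝ) → (Fin K → ℝ) → Fin K → ℝ}
    {M : ℝ} {η : ℕ → ℝ} {a : ℕ → Fin K} {y : ℕ → ℝ} {wt : ℕ → Fin K → ℝ}
    (h : IsRun grad M η (fun t : ℕ => 1 / (4 * √(t : ℝ))) a y wt) {t : ℕ}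
    (ht : 256 * K ^ 4 ≤ t) (b : Fin K) : √(t : ℝ) / (16 * K) ≤ pulls a t b := by
  have hK := natCast_arms_pos (K := K)
  have hK1 : 1 ≤ K := Nat.one_le_iff_ne_zero.2 (NeZero.ne K)
  have h2K : 2 * K ≤ t := by
    have : K ≤ K ^ 4 := Nat.le_self_pow (by norm_num) K
    omega
  have h2K' : (2 : ℝ) * K ≤ t := by exact_mod_cast h2K
  have ht0 : (0 : ℝ) < t := by linarith
  have hs : 0 < √(t : ℝ) := Real.sqrt_pos.2 ht0
  have hss := Real.mul_self_sqrt ht0.le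
  have h1 := h.forced_exploration rfl (t := t) (by omega) b
  have h3 : √(t : ℝ) / (8 * K) ≤ (t - K) / (4 * K * √t) := by
    rw [div_le_div_iff₀ (by positivity) (by positivity)]
    calc √(t : ℝ) * (4 * K * √t) = 4 * K * (√(t : ℝ) * √t) := by ring
      _ = 4 * K * t := by rw [hss]
      _ ≤ (t - K) * (8 * K) := by nlinarith
  have h4 : (K : ℝ) ≤ √(t : ℝ) / (16 * K) := by
    rw [le_div_iff₀ (by positivity)]
    refine Real.le_sqrt_of_sq_le ?_
    have : (256 : ℝ) * K ^ 4 ≤ t := by exact_mod_cast ht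
    linarith [show ((K : ℝ) * (16 * K)) ^ 2 = 256 * K ^ 4 by ring]
  have h5 : √(t : ℝ) / (8 * K) = √(t : ℝ) / (16 * K) + √(t : ℝ) / (16 * K) := by
    field_simp; norm_num
  linarith

/-! ### The expected stopping time -/

lemma threshold_le {K : ℕ} {n : Fin K → ℕ} {T : ℕ} (hn : ∀ b, 1 ≤ n b) (hT : ∀ b, n b ≤ T) (δ : ℝ) :
    threshold n δ ≤ Real.log (1 / δ) + K * Real.log (4 * Real.log (1 / δ) + 1)
      + (6 * K * Real.log (Real.log T + 3) + K * thresholdConst) := by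
  have h1 : ∑ b, Real.log (Real.log (n b : ℝ) + 3) ≤ ∑ _b : Fin K, Real.log (Real.log T + 3) := by
    refine Finset.sum_le_sum fun b _ => ?_
    have h2 : (1 : ℝ) ≤ n b := by exact_mod_cast hn b
    have h3 : (n b : ℝ) ≤ T := by exact_mod_cast hT b
    have h4 : 0 ≤ Real.log (n b : ℝ) := Real.log_nonneg h2
    have h5 : Real.log (n b : ℝ) ≤ Real.log T := Real.log_le_log (by linarith) h3
    exact Real.log_le_log (by linarith) (by linarith)
  rw [Finset.sum_const, Finset.card_univ, Fintype.card_fin, nsmul_eq_mul] at h1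
  unfold threshold
  linarith

lemma eventually_loglog_le (K : ℕ) {c : ℝ} (hc : 0 < c) :
    ∀ᶠ T : ℕ in atTop, 6 * K * Real.log (Real.log T + 3) + K * thresholdConst ≤ c * T := by
  have h1 : Tendsto (fun T : ℕ => Real.log (T : ℝ) / T) atTop (𝓝 0) := by
    have := Real.isLittleO_log_id_atTop.tendsto_div_nhds_zero
    exact this.comp tendsto_natCast_atTop_atTop
  have h2 : Tendsto (fun T : ℕ => (12 * K + K * thresholdConst) / (T : ℝ)) atTop (𝓝 0) :=
    tendsto_const_nhds.div_atTop tendsto_natCast_atTop_atTop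
  have h3 : Tendsto (fun T : ℕ => 6 * K * (Real.log (T : ℝ) / T)
      + (12 * K + K * thresholdConst) / (T : ℝ)) atTop (𝓝 0) := by
    simpa using (h1.const_mul (6 * K : ℝ)).add h2
  filter_upwards [h3.eventually_le_const hc, eventually_ge_atTop 1] with T hT hT1
  have hT1' : (1 : ℝ) ≤ T := by exact_mod_cast hT1
  have hT0 : (0 : ℝ) < T := by linarith
  have hlog : 0 ≤ Real.log (T : ℝ) := Real.log_nonneg hT1'
  have h4 := Real.log_le_sub_one_of_pos (x := Real.log (T : ℝ) + 3) (by linarith)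
  have h5 : 6 * K * Real.log (Real.log (T : ℝ) + 3) ≤ 6 * K * (Real.log (T : ℝ) + 2) := by
    gcongr
    linarith
  have h6 : 6 * K * (Real.log (T : ℝ) / T) + (12 * K + K * thresholdConst) / (T : ℝ) =
      (6 * K * Real.log (T : ℝ) + (12 * K + K * thresholdConst)) / T := by ring
  rw [h6, div_le_iff₀ hT0] at hT
  linarith

section

variable {K : ℕ} [NeZero K] {I : Type*} {S : I → Set (Fin K → ℝ)}
  {grad : (Fin K → ℝ) → (Fin K → ℝ) → Fin K → ℝ} {M : ℝ}

/-- The point is that `D` does not depend on `δ`. With `c < c₁ < c'`, good runs have statistic at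
least `c₁ T`: the part `c T` covers the `δ`-terms of the threshold once `T ≥ β / c`, and `(c₁ - c)
T` covers its `log log T` terms. -/
lemma lintegral_stopTime_le (hopen : ∀ i, IsOpen (S i))
    (hdisj : ∀ i j, i ≠ j → Disjoint (S i) (S j))
    (hne : ∃ i j, i ≠ j ∧ (S i).Nonempty ∧ (S j).Nonempty)
    (hgrad : IsSubgradientSelection S grad) (hbdd : BoundedSubgradients S grad) (hM : 0 < M)
    {Ω : Type*} [MeasurableSpace Ω] {P : Measure Ω} [IsProbabilityMeasure P]
    {A : ℕ → Ω → Fin K} {Y : ℕ → Ω → ℝ}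
    {hA : ∀ t, Measurable (A t)} {hY : ∀ t, Measurable (Y t)}
    (hsampling : ∀ t, Measurable[history hA hY t] (A (t + 1)))
    {i : I} {μ : Fin K → ℝ} (hμ : μ ∈ S i) (hP : IsGaussianBandit hA hY μ P)
    {wt : Ω → ℕ → Fin K → ℝ}
    (hrun : ∀ ω, IsRun grad M (fun t => 1 / √(t : ℝ)) (fun t => 1 / (4 * √(t : ℝ)))
      (fun t => A t ω) (fun t => Y t ω) (wt ω))
    {v : Fin K → ℝ} (hv : v ∈ stdSimplex ℝ (Fin K))
    {c c' : ℝ} (hc : 0 < c) (hcc : c < c') (hvc : ∀ lam ∈ alt S μ, c' ≤ cost v μ lam) :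
    ∃ D : ℝ, 0 ≤ D ∧ ∀ δ : ℝ, 0 < δ → δ < 1 →
      ∫⁻ ω, (stopTime S threshold δ (fun t => A t ω) (fun t => Y t ω) : ℝ≥0∞) ∂P ≤
        ENNReal.ofReal (D + (Real.log (1 / δ) + K * Real.log (4 * Real.log (1 / δ) + 1)) / c) := by
  have hK := natCast_arms_pos (K := K)
  have hK1 : 1 ≤ K := Nat.one_le_iff_ne_zero.2 (NeZero.ne K)
  obtain ⟨c₁, hcc₁, hc₁c'⟩ := exists_between hcc
  obtain ⟨ξ, hξ, T₀, hcore⟩ := exists_radius_le_cost_pulls hopen hdisj hne hgrad hbdd hM hμ hv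
    (hc.trans hcc₁) hc₁c' hvc
  obtain ⟨T₂, hT₂⟩ := eventually_atTop.1 (eventually_loglog_le K (sub_pos.2 hcc₁))
  set t₁ := 256 * K ^ 4
  -- Small `t` are excluded because the exploration bound starts at `t₁`. Nothing is lost: `t₁ ^ 2 ≤
  -- T ≤ t ^ 2` forces `t ≥ t₁`.
  set B : ℕ → Set Ω := fun t => {ω | t₁ ≤ t ∧
    ∃ b, ξ ≤ |empMean (fun s => A s ω) (fun s => Y s ω) t b - μ b|} with hB
  have hPB : ∀ t, P (B t) ≤
      ENNReal.ofReal (2 * K * Real.exp (-(ξ ^ 2 / (32 * K) * √(t : ℝ)))) := by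
    intro t
    by_cases ht : t₁ ≤ t
    · have hsub : B t ⊆ ⋃ b : Fin K, {ω | √(t : ℝ) / (16 * K) ≤ pulls (fun s => A s ω) t b ∧
          ξ ≤ |empMean (fun s => A s ω) (fun s => Y s ω) t b - μ b|} := by
        rintro ω ⟨-, b, hb⟩
        exact Set.mem_iUnion.2 ⟨b, (hrun ω).sqrt_le_pulls ht b, hb⟩
      calc P (B t) ≤ ∑ b : Fin K, P {ω | √(t : ℝ) / (16 * K) ≤ pulls (fun s => A s ω) t b ∧
          ξ ≤ |empMean (fun s => A s ω) (fun s => Y s ω) t b - μ b|} :=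
            (measure_mono hsub).trans (measure_iUnion_fintype_le _ _)
        _ ≤ ∑ _b : Fin K, 2 * ENNReal.ofReal
            (Real.exp (-(ξ ^ 2 * (√(t : ℝ) / (16 * K)) / 2))) :=
            Finset.sum_le_sum fun b _ => measure_empMean_sub_ge_le hsampling hP hξ t b
        _ = _ := by
            rw [Finset.sum_const, Finset.card_univ, Fintype.card_fin, nsmul_eq_mul,
              ENNReal.ofReal_mul (by positivity), ENNReal.ofReal_mul (by norm_num),
              ENNReal.ofReal_natCast, ENNReal.ofReal_ofNat]
            have : ξ ^ 2 * (√(t : ℝ) / (16 * K)) / 2 = ξ ^ 2 / (32 * K) * √(t : ℝ) := by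
              field_simp; ring
            rw [this]
            ring
    · have : B t = ∅ := Set.eq_empty_of_forall_notMem fun ω hω => ht hω.1
      rw [this, measure_empty]
      exact bot_le
  have hsummable : Summable fun t : ℕ => ((t : ℝ) ^ 2 + 1) *
      (2 * K * Real.exp (-(ξ ^ 2 / (32 * K) * √(t : ℝ)))) := by
    refine ((summable_sq_add_one_mul_exp_neg_sqrt
      (c := ξ ^ 2 / (32 * K)) (by positivity)).mul_left (2 * K : ℝ)).congr fun t => ?_
    ring
  set D₀ := ∑' t : ℕ, ((t : ℝ) ^ 2 + 1) * (2 * K * Real.exp (-(ξ ^ 2 / (32 * K) * √(t : ℝ))))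
  have hD₀ : 0 ≤ D₀ := tsum_nonneg fun t => by positivity
  have hsum : ∑' t : ℕ, ((t : ℝ≥0∞) ^ 2 + 1) * P (B t) ≤ ENNReal.ofReal D₀ := by
    rw [ENNReal.ofReal_tsum_of_nonneg (fun t => by positivity) hsummable]
    refine ENNReal.tsum_le_tsum fun t => ?_
    rw [ENNReal.ofReal_mul (by positivity)]
    refine mul_le_mul' (le_of_eq ?_) (hPB t)
    rw [ENNReal.ofReal_add (by positivity) (by norm_num), ENNReal.ofReal_pow (by positivity)]
    simp
  set T₃ := max (max T₀ T₂) (max (t₁ ^ 2) K)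
  refine ⟨T₃ + 1 + D₀, by positivity, fun δ hδ hδ1 => ?_⟩
  have hℓ : 0 < Real.log (1 / δ) := Real.log_pos (by rw [lt_div_iff₀ hδ]; linarith)
  set β := Real.log (1 / δ) + K * Real.log (4 * Real.log (1 / δ) + 1)
  have hβ : 0 ≤ β := add_nonneg hℓ.le (mul_nonneg hK.le (Real.log_nonneg (by linarith)))
  have hbound := lintegral_le_add_tsum_bad (P := P)
    (fun ω => stopTime S threshold δ (fun t => A t ω) (fun t => Y t ω)) B (T₃ + ⌈β / c⌉₊) ?_
  · refine hbound.trans ((add_le_add le_rfl hsum).trans ?_)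
    rw [← ENNReal.ofReal_natCast, ← ENNReal.ofReal_add (by positivity) hD₀]
    refine ENNReal.ofReal_le_ofReal ?_
    push_cast
    linarith [(Nat.ceil_lt_add_one (div_nonneg hβ hc.le)).le]
  · intro ω T hT hgood
    have hT0 : T₀ ≤ T := by omega
    have hT2 : T₂ ≤ T := by omega
    have hT1 : t₁ ^ 2 ≤ T := by omega
    have hTK : K ≤ T := by omega
    have hTβ : β ≤ c * T := by
      have h1 : (⌈β / c⌉₊ : ℝ) ≤ T := by exact_mod_cast (by omega : ⌈β / c⌉₊ ≤ T)
      have h2 := (Nat.le_ceil (β / c)).trans h1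
      rw [div_le_iff₀ hc] at h2
      linarith
    refine sInf_le ⟨T, rfl, hTK, le_infCost fun lam hlam => ?_⟩
    refine le_trans ?_ (hcore _ _ _ (hrun ω) T hT0 (fun t htT hTt b => ?_) lam hlam)
    · refine (threshold_le (T := T) (fun b => ?_) (fun b => pulls_le _ _ b) δ).trans ?_
      · rw [← (hrun ω).init_pulls b]
        exact pulls_mono _ hTK b
      · have := hT₂ T hT2
        linarith
    · by_contra hcon
      refine hgood t htT hTt ⟨?_, b, not_lt.1 hcon⟩
      exact (Nat.pow_le_pow_iff_left (by norm_num : 2 ≠ 0)).1 (hT1.trans hTt)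

end

/-! ### Measurability of the stopping rule -/

section

variable {K : ℕ} {I Ω : Type*}

/-- The set of alternatives varies with `μ`; this form isolates that dependence in the conditions `μ
∈ S i`, leaving infima over fixed sets. -/
lemma infCost_alt_eq (S : I → Set (Fin K → ℝ)) (w μ : Fin K → ℝ) [∀ i, Decidable (μ ∈ S i)] :
    infCost w μ (alt S μ) = ⨅ i, if μ ∈ S i then ⊤ else infCost w μ (S i) := by
  refine le_antisymm (le_iInf fun i => ?_) (le_iInf₂ fun lam hlam => ?_)
  · split_ifs with h
    · exact le_top
    · exact infCost_mono_set w μ fun lam hl => mem_alt.2 ⟨i, h, hl⟩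
  · obtain ⟨i, hi, hl⟩ := mem_alt.1 hlam
    refine (iInf_le _ i).trans ?_
    rw [if_neg hi]
    exact infCost_le hl

/-- The infimum is uncountable, but an infimum of continuous functions is upper semicontinuous. -/
lemma measurable_infCost (B : Set (Fin K → ℝ)) :
    Measurable fun p : (Fin K → ℝ) × (Fin K → ℝ) => infCost p.1 p.2 B := by
  refine UpperSemicontinuous.measurable (upperSemicontinuous_biInf fun lam _ => ?_)
  refine Continuous.upperSemicontinuous (ENNReal.continuous_ofReal.comp ?_)
  unfold gaussDiv
  fun_prop

lemma measurable_infCost_alt [Finite I] {S : I → Set (Fin K → ℝ)} (hopen : ∀ i, IsOpen (S i)) :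
    Measurable fun p : (Fin K → ℝ) × (Fin K → ℝ) => infCost p.1 p.2 (alt S p.2) := by
  classical
  simp only [infCost_alt_eq]
  refine Measurable.iInf fun i => Measurable.ite ?_ measurable_const (measurable_infCost _)
  exact measurable_snd (hopen i).measurableSet

lemma stopTime_le_iff {S : I → Set (Fin K → ℝ)} {β : (Fin K → ℕ) → ℝ → ℝ} {δ : ℝ}
    {a : ℕ → Fin K} {y : ℕ → ℝ} {t : ℕ} : stopTime S β δ a y ≤ t ↔
      ∃ s ≤ t, K ≤ s ∧ ENNReal.ofReal (β (pulls a s) δ) ≤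
        infCost (fun b => (pulls a s b : ℝ)) (empMean a y s) (alt S (empMean a y s)) := by
  constructor
  · intro h
    have hne : {n : ℕ∞ | ∃ t : ℕ, n = t ∧ K ≤ t ∧ ENNReal.ofReal (β (pulls a t) δ) ≤
        infCost (fun b => (pulls a t b : ℝ)) (empMean a y t)
          (alt S (empMean a y t))}.Nonempty := by
      by_contra hcon
      rw [stopTime, Set.not_nonempty_iff_eq_empty.1 hcon, sInf_empty] at h
      exact absurd h (not_le.2 (ENat.natCast_lt_top t))
    obtain ⟨s, hs, h1, h2⟩ := csInf_mem hne
    refine ⟨s, ?_, h1, h2⟩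
    rw [stopTime, hs] at h
    exact_mod_cast h
  · rintro ⟨s, hst, h1, h2⟩
    exact le_trans (b := (s : ℕ∞)) (sInf_le ⟨s, rfl, h1, h2⟩) (by exact_mod_cast hst)

lemma stopTime_spec {S : I → Set (Fin K → ℝ)} {β : (Fin K → ℕ) → ℝ → ℝ} {δ : ℝ}
    {a : ℕ → Fin K} {y : ℕ → ℝ} {t : ℕ} (h : stopTime S β δ a y = t) :
      K ≤ t ∧ ENNReal.ofReal (β (pulls a t) δ) ≤
        infCost (fun b => (pulls a t b : ℝ)) (empMean a y t) (alt S (empMean a y t)) := by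
  obtain ⟨s, hst, h1, h2⟩ := stopTime_le_iff.1 h.le
  have h3 : stopTime S β δ a y ≤ s := stopTime_le_iff.2 ⟨s, le_rfl, h1, h2⟩
  rw [h] at h3
  obtain rfl : s = t := le_antisymm hst (by exact_mod_cast h3)
  exact ⟨h1, h2⟩

lemma measurable_pulls {m : MeasurableSpace Ω} {A : ℕ → Ω → Fin K} {t : ℕ}
    (hA : ∀ s ∈ Set.Icc 1 t, Measurable (A s)) :
    Measurable fun ω => pulls (fun s => A s ω) t := by
  refine measurable_pi_lambda _ fun b => ?_
  simp only [pulls, Finset.card_filter]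
  exact Finset.measurable_sum _ fun s hs => Measurable.ite
    (hA s (Finset.mem_Icc.1 hs) (measurableSet_singleton b)) measurable_const measurable_const

lemma measurable_empMean {m : MeasurableSpace Ω} {A : ℕ → Ω → Fin K} {Y : ℕ → Ω → ℝ} {t : ℕ}
    (hA : ∀ s ∈ Set.Icc 1 t, Measurable (A s)) (hY : ∀ s ∈ Set.Icc 1 t, Measurable (Y s)) :
    Measurable fun ω => empMean (fun s => A s ω) (fun s => Y s ω) t := by
  refine measurable_pi_lambda _ fun b => ?_
  have h1 : Measurable fun ω => (pulls (fun s => A s ω) t b : ℝ) :=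
    (measurable_from_top (f := fun n : ℕ => (n : ℝ))).comp
      ((measurable_pi_apply b).comp (measurable_pulls hA))
  refine (measurable_const.div h1).mul (Finset.measurable_sum _ fun s hs => ?_)
  exact Measurable.ite (hA s (Finset.mem_Icc.1 hs) (measurableSet_singleton b))
    (hY s (Finset.mem_Icc.1 hs)) measurable_const

lemma measurableSet_threshold_le_infCost [Finite I] {m : MeasurableSpace Ω} {S : I → Set (Fin K → ℝ)}
    (hopen : ∀ i, IsOpen (S i)) (β : (Fin K → ℕ) → ℝ → ℝ) (δ : ℝ) {A : ℕ → Ω → Fin K}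
    {Y : ℕ → Ω → ℝ} {t : ℕ} (hA : ∀ s ∈ Set.Icc 1 t, Measurable (A s))
    (hY : ∀ s ∈ Set.Icc 1 t, Measurable (Y s)) :
    MeasurableSet {ω | ENNReal.ofReal (β (pulls (fun s => A s ω) t) δ) ≤
      infCost (fun b => (pulls (fun s => A s ω) t b : ℝ))
        (empMean (fun s => A s ω) (fun s => Y s ω) t)
        (alt S (empMean (fun s => A s ω) (fun s => Y s ω) t))} := by
  have h1 := measurable_pulls hA
  have h2 : Measurable fun n : Fin K → ℕ => ENNReal.ofReal (β n δ) := Measurable.of_discrete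
  have h3 : Measurable fun n : Fin K → ℕ => fun b => (n b : ℝ) := Measurable.of_discrete
  have h4 := (measurable_infCost_alt hopen).comp ((h3.comp h1).prodMk (measurable_empMean hA hY))
  have h5 := h2.comp h1
  simp only [Function.comp_def] at h4 h5
  exact measurableSet_le h5 h4

lemma isStoppingTime_stopTime [Finite I] [mΩ : MeasurableSpace Ω] {S : I → Set (Fin K → ℝ)}
    (hopen : ∀ i, IsOpen (S i)) (β : (Fin K → ℕ) → ℝ → ℝ) (δ : ℝ) {A : ℕ → Ω → Fin K}
    {Y : ℕ → Ω → ℝ} (hA : ∀ t, Measurable (A t)) (hY : ∀ t, Measurable (Y t)) (t : ℕ) :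
    MeasurableSet[history hA hY t]
      {ω | stopTime S β δ (fun t => A t ω) (fun t => Y t ω) ≤ (t : ℕ∞)} := by
  simp only [stopTime_le_iff]
  have : {ω | ∃ s ≤ t, K ≤ s ∧ ENNReal.ofReal (β (pulls (fun s => A s ω) s) δ) ≤
      infCost (fun b => (pulls (fun s => A s ω) s b : ℝ))
        (empMean (fun s => A s ω) (fun s => Y s ω) s)
        (alt S (empMean (fun s => A s ω) (fun s => Y s ω) s))} =
      ⋃ s ∈ {s | s ≤ t ∧ K ≤ s}, {ω | ENNReal.ofReal (β (pulls (fun s => A s ω) s) δ) ≤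
      infCost (fun b => (pulls (fun s => A s ω) s b : ℝ))
        (empMean (fun s => A s ω) (fun s => Y s ω) s)
        (alt S (empMean (fun s => A s ω) (fun s => Y s ω) s))} := by
    ext ω
    simp [and_assoc]
  rw [this]
  refine MeasurableSet.biUnion (Set.to_countable _) fun s hs => ?_
  exact (history hA hY).mono hs.1 _ (measurableSet_threshold_le_infCost hopen β δ
    (fun r hr => measurable_history_arm hA hY hr) fun r hr => measurable_history_reward hA hY hr)

end

/-! ### Correctness -/

section

lemma threshold_pos {K : ℕ} {n : Fin K → ℕ} (hn : ∀ b, 1 ≤ n b) {δ : ℝ} (hδ : 0 < δ) (hδ1 : δ < 1) :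
    0 < threshold n δ := by
  have hℓ : 0 < Real.log (1 / δ) := Real.log_pos (by rw [lt_div_iff₀ hδ]; linarith)
  have h1 : 0 ≤ Real.log (4 * Real.log (1 / δ) + 1) := Real.log_nonneg (by linarith)
  have h2 : 0 ≤ ∑ b, Real.log (Real.log (n b : ℝ) + 3) := Finset.sum_nonneg fun b _ => by
    have h3 : (1 : ℝ) ≤ n b := by exact_mod_cast hn b
    exact Real.log_nonneg (by linarith [Real.log_nonneg h3])
  have h3 : 0 ≤ thresholdConst := by
    have := Real.log_two_gt_d9
    rw [thresholdConst_eq]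
    linarith
  unfold threshold
  positivity

/-- If the decision is wrong, then the cost of the true means exceeds the threshold. -/
lemma threshold_le_cost_of_ne {K : ℕ} {I : Type*} {S : I → Set (Fin K → ℝ)} {a : ℕ → Fin K} {y : ℕ → ℝ} {t : ℕ}
    (hpulls : ∀ b, 1 ≤ pulls a t b) {δ : ℝ} (hδ : 0 < δ) (hδ1 : δ < 1)
    (hthr : ENNReal.ofReal (threshold (pulls a t) δ) ≤
      infCost (fun b => (pulls a t b : ℝ)) (empMean a y t) (alt S (empMean a y t)))
    {i j : I} (hj : IsDecision S a y t j) (hij : j ≠ i) {μ : Fin K → ℝ} (hμ : μ ∈ S i)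
    (hdisj : ∀ i j, i ≠ j → Disjoint (S i) (S j)) :
    threshold (pulls a t) δ ≤ cost (fun b => (pulls a t b : ℝ)) (empMean a y t) μ := by
  have hpos := threshold_pos hpulls hδ hδ1
  -- If the empirical means lie in `S i`, index `i` has cost zero, hence so has the chosen `j`. But
  -- `S j` then consists of alternatives, whose cost is at least the positive threshold.
  by_cases hmem : empMean a y t ∈ S i
  · exfalso
    have h1 := hj i
    rw [infCost_eq_zero hmem] at h1
    have hsub : S j ⊆ alt S (empMean a y t) := fun lam hl =>
      mem_alt.2 ⟨j, fun h => (hdisj j i hij).le_bot ⟨h, hmem⟩, hl⟩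
    exact absurd ((hthr.trans (infCost_mono_set _ _ hsub)).trans h1)
      (not_le.2 (ENNReal.ofReal_pos.2 hpos))
  · exact (ENNReal.ofReal_le_ofReal_iff (cost_nonneg (fun _ => Nat.cast_nonneg _) _ _)).1
      (hthr.trans (infCost_le (mem_alt.2 ⟨i, hmem, hμ⟩)))

variable {K : ℕ} [NeZero K] {I : Type*} {S : I → Set (Fin K → ℝ)}

/-- The uniform weights separate `μ` from its alternatives. -/
lemma exists_pos_le_cost_unif {i : I} (hopen : IsOpen (S i))
    {μ : Fin K → ℝ} (hμ : μ ∈ S i) (hdisj : ∀ i j, i ≠ j → Disjoint (S i) (S j)) :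
    ∃ c : ℝ, 0 < c ∧ ∀ lam ∈ alt S μ, c ≤ cost (unif K) μ lam := by
  have hK := natCast_arms_pos (K := K)
  obtain ⟨r, hr, hball⟩ := Metric.isOpen_iff.1 hopen μ hμ
  refine ⟨1 / K * (r ^ 2 / 2), by positivity, fun lam hlam => ?_⟩
  obtain ⟨j, hj, hl⟩ := mem_alt.1 hlam
  have hli : lam ∉ S i := fun h => by
    by_cases hij : j = i
    · exact hj (hij ▸ hμ)
    · exact (hdisj j i hij).le_bot ⟨hl, h⟩
  have hdist : ¬ dist lam μ < r := fun h => hli (hball h)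
  rw [dist_pi_lt_iff hr] at hdist
  push Not at hdist
  obtain ⟨b, hb⟩ := hdist
  rw [Real.dist_eq] at hb
  calc 1 / (K : ℝ) * (r ^ 2 / 2) ≤ unif K b * gaussDiv (μ b) (lam b) := by
        have h2 := pow_le_pow_left₀ hr.le hb 2
        rw [abs_sub_comm, sq_abs] at h2
        exact mul_le_mul_of_nonneg_left (by unfold gaussDiv; linarith) (by positivity)
    _ ≤ _ := Finset.single_le_sum
        (f := fun b => unif K b * gaussDiv (μ b) (lam b))
        (fun c _ => mul_nonneg (by simp [unif]) (gaussDiv_nonneg _ _)) (Finset.mem_univ b)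

/-- The bound on the expected stopping time is equivalent to `log (1 / δ) / c`. -/
lemma tendsto_time_bound (K : ℕ) (D : ℝ) {c : ℝ} :
    Tendsto (fun δ : ℝ => (D + (Real.log (1 / δ) + K * Real.log (4 * Real.log (1 / δ) + 1)) / c) /
      Real.log (1 / δ)) (𝓝[>] 0) (𝓝 (1 / c)) := by
  have hlog : Tendsto (fun δ : ℝ => Real.log (1 / δ)) (𝓝[>] 0) atTop := by
    simp only [one_div]
    exact Real.tendsto_log_atTop.comp tendsto_inv_nhdsGT_zero
  have h1 : Tendsto (fun x : ℝ => 4 * x + 1) atTop atTop :=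
    tendsto_atTop_add_const_right _ _ (tendsto_id.const_mul_atTop (by norm_num))
  have h2 : Tendsto (fun x : ℝ => Real.log (4 * x + 1) / (4 * x + 1)) atTop (𝓝 0) :=
    Real.isLittleO_log_id_atTop.tendsto_div_nhds_zero.comp h1
  have h3 : Tendsto (fun x : ℝ => 4 + 1 / x) atTop (𝓝 (4 + 0)) :=
    tendsto_const_nhds.add (tendsto_const_nhds.div_atTop tendsto_id)
  -- With `x = log (1 / δ)`, `log (4 x + 1) / x` is written as `log (4 x + 1) / (4 x + 1)` times `4
  -- + 1 / x`.
  have h4 : Tendsto (fun x : ℝ => D / x + (1 + K * (Real.log (4 * x + 1) / (4 * x + 1) *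
      (4 + 1 / x))) / c) atTop (𝓝 (0 + (1 + K * (0 * (4 + 0))) / c)) :=
    (tendsto_const_nhds.div_atTop tendsto_id).add
      ((tendsto_const_nhds.add ((h2.mul h3).const_mul _)).div_const c)
  have h5 : Tendsto (fun x : ℝ => (D + (x + K * Real.log (4 * x + 1)) / c) / x) atTop
      (𝓝 (1 / c)) := by
    have h6 : (0 : ℝ) + (1 + K * (0 * (4 + 0))) / c = 1 / c := by simp
    rw [h6] at h4
    refine h4.congr' ?_
    filter_upwards [eventually_gt_atTop 0] with x hx
    have : 4 * x + 1 ≠ 0 := by positivity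
    field_simp
  exact h5.comp hlog

end

end ActiveExploration

/-! ### Main theorem: correctness, almost sure stopping and the asymptotic bound. -/

theorem mainTheorem1 {K : ℕ} (hK : 2 ≤ K) {I : Type*} [Finite I]
    (S : I → Set (Fin K → ℝ))
    (hopen : ∀ i, IsOpen (S i)) (hconv : ∀ i, Convex ℝ (S i))
    (hdisj : ∀ i j, i ≠ j → Disjoint (S i) (S j))
    (hne : ∃ i j, i ≠ j ∧ (S i).Nonempty ∧ (S j).Nonempty)
    (grad : (Fin K → ℝ) → (Fin K → ℝ) → Fin K → ℝ)
    (hgrad : ActiveExploration.IsSubgradientSelection S grad)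
    (hbdd : ActiveExploration.BoundedSubgradients S grad)
    (M : ℝ) (hM : 0 < M)
    {Ω : Type*} [MeasurableSpace Ω]
    (P : (Fin K → ℝ) → Measure Ω) [∀ μ, IsProbabilityMeasure (P μ)]
    (A : ℕ → Ω → Fin K) (Y : ℕ → Ω → ℝ)
    (hA : ∀ t, Measurable (A t)) (hY : ∀ t, Measurable (Y t))
    (hsampling : ∀ t, Measurable[ActiveExploration.history hA hY t] (A (t + 1)))
    (hbandit : ∀ μ, ActiveExploration.IsGaussianBandit hA hY μ (P μ))
    (wt : Ω → ℕ → Fin K → ℝ)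
    (hrun : ∀ ω, ActiveExploration.IsRun grad M (fun t => 1 / √(t : ℝ))
      (fun t => 1 / (4 * √(t : ℝ))) (fun t => A t ω) (fun t => Y t ω) (wt ω))
    (τ : ℝ → Ω → ℕ∞)
    (hτ : ∀ δ ω, τ δ ω = ActiveExploration.stopTime S ActiveExploration.threshold δ
      (fun t => A t ω) (fun t => Y t ω))
    (ihat : ℝ → Ω → I)
    (hdecision : ∀ δ, 0 < δ → δ < 1 → ∀ ω, ∀ t : ℕ, τ δ ω = t →
      ActiveExploration.IsDecision S (fun t => A t ω) (fun t => Y t ω) t (ihat δ ω))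
    (hdecision_meas : ∀ δ, 0 < δ → δ < 1 → ∀ i, ∀ t : ℕ,
      MeasurableSet[ActiveExploration.history hA hY t]
        ({ω | ihat δ ω = i} ∩ {ω | τ δ ω ≤ t})) :
    (∀ δ, 0 < δ → δ < 1 →
      ActiveExploration.IsDeltaCorrect S hA hY P (τ δ) (ihat δ) δ) ∧
    ∀ μ ∈ ⋃ i, S i,
      limsup (fun δ : ℝ => (∫⁻ ω, (τ δ ω : ℝ≥0∞) ∂(P μ)) / ENNReal.ofReal (Real.log (1 / δ)))
        (𝓝[>] 0) ≤ ActiveExploration.charTime S μ := by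
  open ActiveExploration in
  have : NeZero K := ⟨by omega⟩
  obtain rfl : τ = fun δ ω => stopTime S threshold δ (fun t => A t ω) (fun t => Y t ω) :=
    funext fun δ => funext fun ω => hτ δ ω
  have hstopping : ∀ δ, IsStoppingTime (history hA hY)
      (fun ω => stopTime S threshold δ (fun t => A t ω) (fun t => Y t ω)) := fun δ t =>
    isStoppingTime_stopTime hopen threshold δ hA hY t
  -- A finite expectation suffices, so any weights with a positive gap will do; openness of `S i`
  -- provides one for the uniform weights.
  have hfinite : ∀ δ, 0 < δ → δ < 1 → ∀ i, ∀ μ ∈ S i, ∀ᵐ ω ∂(P μ),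
      stopTime S threshold δ (fun t => A t ω) (fun t => Y t ω) < ⊤ := by
    intro δ hδ hδ1 i μ hμ
    obtain ⟨c, hc, hvc⟩ := exists_pos_le_cost_unif (hopen i) hμ hdisj
    have hunif : unif K ∈ stdSimplex ℝ (Fin K) := by
      rw [unif_eq_softmax_zero]
      exact softmax_mem_stdSimplex _
    obtain ⟨D, -, hD⟩ := lintegral_stopTime_le hopen hdisj hne hgrad hbdd hM hsampling hμ
      (hbandit μ) hrun hunif (half_pos hc) (half_lt_self hc) hvc
    have hmeas : Measurable fun ω =>
        (stopTime S threshold δ (fun t => A t ω) (fun t => Y t ω) : ℝ≥0∞) := by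
      refine (Measurable.of_discrete (f := fun n : ℕ∞ => (n : ℝ≥0∞))).comp ?_
      exact ENat.measurable_iff.2 fun n =>
        (history hA hY).le n _ ((hstopping δ).measurableSet_eq n)
    filter_upwards [ae_lt_top hmeas (ne_top_of_le_ne_top ENNReal.ofReal_ne_top (hD δ hδ hδ1))]
      with ω hω
    exact ENat.toENNReal_lt_top.1 hω
  refine ⟨fun δ hδ hδ1 => ?_, fun μ hμ => ?_⟩
  · refine ⟨hsampling, hstopping δ, hdecision_meas δ hδ hδ1, fun i μ hμ => ?_, fun μ hμ => ?_⟩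
    · have hdev := measure_exists_threshold_le hsampling (hbandit μ) hδ hδ1
      -- The decision rule constrains `ihat` only where `τ` is finite, so the inclusion of events
      -- holds almost everywhere.
      refine (measure_mono_ae ?_).trans hdev
      filter_upwards [hfinite δ hδ hδ1 i μ hμ] with ω hω hne
      obtain ⟨t, ht⟩ := ENat.ne_top_iff_exists.1 hω.ne
      obtain ⟨htK, hthr⟩ := stopTime_spec ht.symm
      have hpulls : ∀ b, 1 ≤ pulls (fun s => A s ω) t b := fun b => by
        rw [← (hrun ω).init_pulls b]
        exact pulls_mono _ htK b
      exact ⟨t, hpulls, threshold_le_cost_of_ne hpulls hδ hδ1 hthr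
        (hdecision δ hδ hδ1 ω t ht.symm) hne hμ hdisj⟩
    · obtain ⟨i, hi⟩ := Set.mem_iUnion.1 hμ
      exact hfinite δ hδ hδ1 i μ hi
  · obtain ⟨i, hi⟩ := Set.mem_iUnion.1 hμ
    rw [charTime, ENNReal.le_inv_iff_le_inv]
    -- After inverting, it suffices to bound the limsup by `1 / c` for every `v` in the simplex and
    -- every `c` below its worst cost; `c'` is the margin needed by `lintegral_stopTime_le`.
    refine iSup₂_le fun v hv => ENNReal.le_of_forall_nnreal_lt fun c hc => ?_
    rcases eq_zero_or_pos c with rfl | hc0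
    · simp
    obtain ⟨c', hcc', hc'⟩ := ENNReal.lt_iff_exists_nnreal_btwn.1 hc
    have hvc : ∀ lam ∈ alt S μ, (c' : ℝ) ≤ cost v μ lam := by
      intro lam hlam
      have h1 := hc'.le.trans (infCost_le hlam)
      rw [← ENNReal.ofReal_coe_nnreal] at h1
      exact (ENNReal.ofReal_le_ofReal_iff (cost_nonneg hv.1 _ _)).1 h1
    obtain ⟨D, -, hD⟩ := lintegral_stopTime_le hopen hdisj hne hgrad hbdd hM hsampling hi
      (hbandit μ) hrun hv (c := c) (by exact_mod_cast hc0)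
      (by exact_mod_cast ENNReal.coe_lt_coe.1 hcc') hvc
    rw [ENNReal.le_inv_iff_le_inv]
    have hlim := (ENNReal.continuous_ofReal.tendsto _).comp (tendsto_time_bound K D (c := c))
    have hval : ENNReal.ofReal (1 / (c : ℝ)) = (c : ℝ≥0∞)⁻¹ := by
      rw [one_div, ENNReal.ofReal_inv_of_pos (by exact_mod_cast hc0), ENNReal.ofReal_coe_nnreal]
    rw [← hval, ← hlim.limsup_eq]
    refine limsup_le_limsup ?_
    filter_upwards [Ioo_mem_nhdsGT one_pos] with δ hδ
    have hℓ : 0 < Real.log (1 / δ) := Real.log_pos (by rw [lt_div_iff₀ hδ.1]; linarith [hδ.2])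
    simp only [Function.comp_apply]
    rw [ENNReal.ofReal_div_of_pos hℓ]
    gcongr
    exact hD δ hδ.1 hδ.2
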